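/- Semigroups are allowed to be empty. For a semigroup $A$ let $\coprod_n A$ denote the coproduct of $n$ copies of $A$ in the category $\mathbf{Semigroup}$; for $n=2$ write $x\mapsto x^{(0)}$, $x\mapsto x^{(1)}$ for the two coprojections $A\to A\amalg A$. A \emph{cosemigroup} (in semigroups) is a pair $S=(|S|,\beta^S)$ of a semigroup $|S|$ and a homomorphism $\beta^S:|S|\to |S|\amalg|S|$ that is coassociative: for homomorphisms $f,g:|S|\to A$ put $f\cdot g=(f,g)\circ\beta^S$, where $(f,g):|S|\amalg|S|\to A$ is the induced map; then the three coprojections $\iota_0,\iota_1,\iota_2:|S|\to\coprod_3|S|$ satisfy $(\iota_0\cdot\iota_1)\cdot\iota_2=\iota_0\cdot(\iota_1\cdot\iota_2)$. A morphism $S\to T$ of cosemigroups is a homomorphism $h:|S|\to|T|$ with $\beta^T h=(h\amalg h)\beta^S$. The operation $f\cdot g$ makes $\mathrm{Hom}(|S|,A)$ a semigroup, functorially in $A$; this is the functor $\mathbf{Semigroup}\to\mathbf{Semigroup}$ represented by $S$. A functor $\mathbf{Semigroup}\to\mathbf{Semigroup}$ is called representable if its composite with the underlying-set functor is representable; the representable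 functors form a full subcategory of the functor category. Theorem. Let $|R|$ be the semigroup with presentation $$\langle x_{00},\,x_{11},\,p_i,\,q_i\ (i\in\omega)\mid x_{00}^2=x_{00},\ x_{11}^2=x_{11},\ x_{00}p_i=p_i=p_ix_{11},\ x_{11}q_i=q_i=q_ix_{00}\rangle,$$ and let $\beta^R:|R|\to|R|\amalg|R|$ be the homomorphism given by $$\beta^R(x_{00})=x_{00}^{(0)},\quad \beta^R(x_{11})=x_{11}^{(1)},\quad \beta^R(p_i)=p_i^{(0)}\bigl(x_{00}^{(1)}x_{11}^{(0)}\bigr)^ip_i^{(1)},\quad \beta^R(q_i)=q_i^{(1)}\bigl(x_{11}^{(0)}x_{00}^{(1)}\bigr)^iq_i^{(0)}.$$ Then $R=(|R|,\beta^R)$ is a cosemigroup, and it is the final object of the category of cosemigroups in semigroups. The functor represented by $R$ is isomorphic, by sending $f:|R|\to A$ to $(f(x_{00});f(x_{11});f(p_i);f(q_i))$, to the functor $E$ taking a semigroup $A$ to the set of tuples $(a;b;c_0,c_1,\dots;d_0,d_1,\dots)$ of elements of $A$ with $a^2=a$, $b^2=b$, $ac_i=c_i=c_ib$, $bd_i=d_i=d_ia$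 for all $i\in\omega$, with multiplication $$(a;b;c_i;d_i)\,(a';b';c'_i;d'_i)=\bigl(a;\ b';\ c_i(a'b)^ic'_i;\ d'_i(ba')^id_i\bigr).$$ Equivalently to the finality of $R$, the functor $E$ is an initial object of the category of representable functors $\mathbf{Semigroup}\to\mathbf{Semigroup}$. -/

import Mathlib

open CategoryTheory CategoryTheory.Limits

universe u v w

namespace FinalCosemigroup

/-! ### Semigroups given by generators and relations

Semigroups are allowed to be empty. -/

/-- The semigroup `⟨α ∣ s = t for all (s, t) with r s t⟩`. -/
def Presented {α : Type u} (r : FreeSemigroup α → FreeSemigroup α → Prop) : Type u :=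
  (conGen r).Quotient

namespace Presented

variable {α : Type u} {r : FreeSemigroup α → FreeSemigroup α → Prop}

instance : Semigroup (Presented r) :=
  inferInstanceAs (Semigroup (conGen r).Quotient)

/-- The class of a word. -/
def mk (r : FreeSemigroup α → FreeSemigroup α → Prop) : FreeSemigroup α →ₙ* Presented r where
  toFun w := ((w : (conGen r).Quotient) : Presented r)
  map_mul' _ _ := rfl

/-- The class of a generator. -/
def of (r : FreeSemigroup α → FreeSemigroup α → Prop) (x : α) : Presented r :=
  mk r (FreeSemigroup.of x)

theorem mk_eq {s t : FreeSemigroup α} (h : r s t) : mk r s = mk r t :=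
  (Con.eq (conGen r)).2 (ConGen.Rel.of s t h)

theorem mk_surjective : Function.Surjective (mk r) := fun x => Quotient.inductionOn' x fun w =>
  ⟨w, rfl⟩

/-- The homomorphism determined by images of the generators that satisfy the relations. -/
def lift {B : Type w} [Semigroup B] (f : α → B)
    (h : ∀ s t, r s t → FreeSemigroup.lift f s = FreeSemigroup.lift f t) :
    Presented r →ₙ* B where
  toFun x := Con.liftOn (c := conGen r) x (FreeSemigroup.lift f) (by
    have key : conGen r ≤ Con.ker (FreeSemigroup.lift f) := Con.conGen_le.2 h
    exact fun a b hab => key hab)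
  map_mul' x y := by
    obtain ⟨s, rfl⟩ := mk_surjective x
    obtain ⟨t, rfl⟩ := mk_surjective y
    exact map_mul (FreeSemigroup.lift f) s t

theorem lift_of {B : Type w} [Semigroup B] (f : α → B)
    (h : ∀ s t, r s t → FreeSemigroup.lift f s = FreeSemigroup.lift f t) (x : α) :
    lift f h (of r x) = f x :=
  FreeSemigroup.lift_of f x

theorem hom_ext {B : Type w} [Semigroup B] {f g : Presented r →ₙ* B}
    (h : ∀ x, f (of r x) = g (of r x)) : f = g := by
  have key : f.comp (mk r) = g.comp (mk r) := FreeSemigroup.hom_ext (funext h)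
  ext x
  obtain ⟨s, rfl⟩ := mk_surjective x
  exact DFunLike.congr_fun key s

end Presented

/-! ### Copowers of semigroups -/

/-- The relations `(i, x) (i, y) = (i, x y)`. -/
inductive CopowerRel (ι : Type) (A : Type u) [Semigroup A] :
    FreeSemigroup (ι × A) → FreeSemigroup (ι × A) → Prop
  | mul (i : ι) (x y : A) :
      CopowerRel ι A (FreeSemigroup.of (i, x) * FreeSemigroup.of (i, y))
        (FreeSemigroup.of (i, x * y))

/-- The copower `∐_ι A`, that is, the coproduct of the constant family `A` indexed by `ι`,
in the category of semigroups. -/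
abbrev Copower (ι : Type) (A : Type u) [Semigroup A] : Type u :=
  Presented (CopowerRel ι A)

namespace Copower

variable {ι : Type} {A : Type u} [Semigroup A]

/-- The `i`-th coprojection, `x ↦ x^(i)`. -/
def inj (i : ι) : A →ₙ* Copower ι A where
  toFun x := Presented.of _ (i, x)
  map_mul' x y := (Presented.mk_eq (CopowerRel.mul i x y)).symm

/-- The homomorphism out of the copower with prescribed composites with the coprojections. -/
def desc {B : Type w} [Semigroup B] (f : ι → A →ₙ* B) : Copower ι A →ₙ* B :=
  Presented.lift (fun ix => f ix.1 ix.2) (by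
    rintro _ _ ⟨i, x, y⟩
    simp [map_mul, FreeSemigroup.lift_of])

theorem desc_inj {B : Type w} [Semigroup B] (f : ι → A →ₙ* B) (i : ι) (x : A) :
    desc f (inj i x) = f i x :=
  Presented.lift_of _ _ _

theorem hom_ext {B : Type w} [Semigroup B] {f g : Copower ι A →ₙ* B}
    (h : ∀ i x, f (inj i x) = g (inj i x)) : f = g :=
  Presented.hom_ext fun ix => h ix.1 ix.2

/-- The map of copowers induced by a homomorphism. -/
def map {B : Type u} [Semigroup B] (f : A →ₙ* B) : Copower ι A →ₙ* Copower ι B :=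
  desc fun i => (inj i).comp f

end Copower

/-! ### Cosemigroups in the category of semigroups -/

/-- The operation on `Hom(A, B)` induced by a co-operation `β : A → A ∐ A`. -/
def conv {A : Type u} [Semigroup A] (β : A →ₙ* Copower (Fin 2) A) {B : Type w} [Semigroup B]
    (f g : A →ₙ* B) : A →ₙ* B :=
  (Copower.desc ![f, g]).comp β

theorem comp_conv {A : Type u} [Semigroup A] (β : A →ₙ* Copower (Fin 2) A) {B : Type v}
    [Semigroup B] {C : Type w} [Semigroup C] (k : B →ₙ* C) (f g : A →ₙ* B) :
    k.comp (conv β f g) = conv β (k.comp f) (k.comp g) := by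
  have : k.comp (Copower.desc ![f, g]) = Copower.desc ![k.comp f, k.comp g] := by
    refine Copower.hom_ext fun i x => ?_
    fin_cases i <;> simp [Copower.desc_inj]
  unfold conv
  rw [← this]
  rfl

/-- The co-operation `β` cosatisfies the associative identity: the three coprojections
`A → A ∐ A ∐ A` associate under the operation induced by `β`. -/
def Coassociative {A : Type u} [Semigroup A] (β : A →ₙ* Copower (Fin 2) A) : Prop :=
  conv β (conv β (Copower.inj (0 : Fin 3)) (Copower.inj 1)) (Copower.inj 2) =
    conv β (Copower.inj (0 : Fin 3)) (conv β (Copower.inj 1) (Copower.inj 2))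

theorem Coassociative.conv_assoc {A : Type u} [Semigroup A] {β : A →ₙ* Copower (Fin 2) A}
    (hβ : Coassociative β) {B : Type w} [Semigroup B] (f g h : A →ₙ* B) :
    conv β (conv β f g) h = conv β f (conv β g h) := by
  have h0 : (Copower.desc ![f, g, h]).comp (Copower.inj (0 : Fin 3)) = f :=
    MulHom.ext fun x => Copower.desc_inj _ _ _
  have h1 : (Copower.desc ![f, g, h]).comp (Copower.inj (1 : Fin 3)) = g :=
    MulHom.ext fun x => Copower.desc_inj _ _ _
  have h2 : (Copower.desc ![f, g, h]).comp (Copower.inj (2 : Fin 3)) = h :=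
    MulHom.ext fun x => Copower.desc_inj _ _ _
  have := congrArg (fun k => (Copower.desc ![f, g, h]).comp k) hβ
  simpa only [comp_conv, h0, h1, h2] using this

end FinalCosemigroup

open FinalCosemigroup in
/-- A cosemigroup in the category of semigroups: a semigroup with a coassociative
co-operation. -/
structure Cosemigroup : Type (u + 1) where
  /-- The underlying semigroup. -/
  carrier : Type u
  [str : Semigroup carrier]
  /-- The co-operation. -/
  comul : carrier →ₙ* Copower (Fin 2) carrier
  coassoc : Coassociative comul

namespace Cosemigroup

open FinalCosemigroup

attribute [instance] Cosemigroup.str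

/-- Morphisms of cosemigroups: semigroup homomorphisms making commuting squares with the
co-operations. -/
@[ext]
structure Hom (S T : Cosemigroup.{u}) : Type u where
  /-- The underlying homomorphism of semigroups. -/
  hom : S.carrier →ₙ* T.carrier
  comm : T.comul.comp hom = (Copower.map hom).comp S.comul

theorem map_id {A : Type u} [Semigroup A] :
    Copower.map (ι := Fin 2) (MulHom.id A) = MulHom.id _ :=
  Copower.hom_ext fun i x => by simp [Copower.map, Copower.desc_inj]

theorem map_comp {A B C : Type u} [Semigroup A] [Semigroup B] [Semigroup C]
    (g : B →ₙ* C) (f : A →ₙ* B) :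
    Copower.map (ι := Fin 2) (g.comp f) = (Copower.map g).comp (Copower.map f) :=
  Copower.hom_ext fun i x => by simp [Copower.map, Copower.desc_inj]

instance : Category Cosemigroup.{u} where
  Hom := Hom
  id S := ⟨MulHom.id _, by rw [map_id]; rfl⟩
  comp f g := ⟨g.hom.comp f.hom, by
    rw [map_comp, MulHom.comp_assoc, ← f.comm, ← MulHom.comp_assoc, g.comm, MulHom.comp_assoc]⟩

/-- The set `Hom(S, A)` of semigroup homomorphisms from a cosemigroup `S` to a semigroup `A`. -/
def Points (S : Cosemigroup.{u}) (A : Type u) [Semigroup A] : Type u :=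
  S.carrier →ₙ* A

instance (S : Cosemigroup.{u}) (A : Type u) [Semigroup A] : Semigroup (S.Points A) where
  mul f g := conv S.comul f g
  mul_assoc f g h := S.coassoc.conv_assoc f g h

/-- The functor represented by a cosemigroup. -/
def representedFunctor (S : Cosemigroup.{u}) : Semigrp.{u} ⥤ Semigrp.{u} where
  obj A := Semigrp.of (S.Points A)
  map {A B} k := Semigrp.ofHom (X := S.Points A) (Y := S.Points B)
    { toFun := fun f => MulHom.comp k.hom f
      map_mul' := fun f g => comp_conv S.comul k.hom f g }

end Cosemigroup

/-- A semigroup-valued functor on semigroups is representable if its composite with the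
underlying-set functor is representable. -/
def IsRepresentableFunctor : ObjectProperty (Semigrp.{u} ⥤ Semigrp.{u}) :=
  fun F => (F ⋙ forget Semigrp.{u}).IsCorepresentable

/-- The category `Rep(Semigroup, Semigroup)` of representable functors, a full subcategory of the
functor category. -/
abbrev RepresentableFunctor : Type (u + 1) :=
  (IsRepresentableFunctor.{u}).FullSubcategory

namespace FinalCosemigroup

/-- `powMul u i y` is the product `u ^ i y` (which is `y` if `i = 0`). -/
def powMul {A : Type u} [Mul A] (u : A) : ℕ → A → A
  | 0, y => y
  | i + 1, y => u * powMul u i y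

theorem map_powMul {A : Type u} {B : Type v} [Mul A] [Mul B] (f : A →ₙ* B) (u : A) (i : ℕ)
    (y : A) : f (powMul u i y) = powMul (f u) i (f y) := by
  induction i with
  | zero => rfl
  | succ i ih => simp [powMul, ih]

theorem powMul_mul {A : Type u} [Semigroup A] (u : A) (i : ℕ) (y z : A) :
    powMul u i y * z = powMul u i (y * z) := by
  induction i with
  | zero => rfl
  | succ i ih => simp [powMul, mul_assoc, ih]

/-! ### The cosemigroup `R` -/

/-- The generators `x₀₀, x₁₁, p_i, q_i` (`i ∈ ω`). -/
inductive Gen : Type u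
  | x00
  | x11
  | p (i : ℕ)
  | q (i : ℕ)

open FreeSemigroup (of)

/-- The defining relations. -/
inductive RRel : FreeSemigroup Gen.{u} → FreeSemigroup Gen.{u} → Prop
  | x00_x00 : RRel (of .x00 * of .x00) (of .x00)
  | x11_x11 : RRel (of .x11 * of .x11) (of .x11)
  | x00_p (i : ℕ) : RRel (of .x00 * of (.p i)) (of (.p i))
  | p_x11 (i : ℕ) : RRel (of (.p i) * of .x11) (of (.p i))
  | x11_q (i : ℕ) : RRel (of .x11 * of (.q i)) (of (.q i))
  | q_x00 (i : ℕ) : RRel (of (.q i) * of .x00) (of (.q i))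

/-- The semigroup presented by the generators and relations above. -/
abbrev RSemigroup : Type u := Presented RRel.{u}

/-- The generators, as elements of the semigroup. -/
def gen (x : Gen.{u}) : RSemigroup.{u} := Presented.of RRel x

theorem x00_x00 : gen .x00 * gen .x00 = gen .x00 := Presented.mk_eq .x00_x00
theorem x11_x11 : gen .x11 * gen .x11 = gen .x11 := Presented.mk_eq .x11_x11
theorem x00_p (i : ℕ) : gen .x00 * gen (.p i) = gen (.p i) := Presented.mk_eq (.x00_p i)
theorem p_x11 (i : ℕ) : gen (.p i) * gen .x11 = gen (.p i) := Presented.mk_eq (.p_x11 i)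
theorem x11_q (i : ℕ) : gen .x11 * gen (.q i) = gen (.q i) := Presented.mk_eq (.x11_q i)
theorem q_x00 (i : ℕ) : gen (.q i) * gen .x00 = gen (.q i) := Presented.mk_eq (.q_x00 i)

/-- The element `x^(j)` of `R ∐ R`, for a generator `x` and `j = 0, 1`. -/
abbrev cp (j : Fin 2) (x : Gen.{u}) : Copower (Fin 2) RSemigroup.{u} :=
  Copower.inj j (gen x)

/-- The values of the co-operation on the generators:
`x₀₀ ↦ x₀₀^(0)`, `x₁₁ ↦ x₁₁^(1)`, `p_i ↦ p_i^(0) (x₀₀^(1) x₁₁^(0))^i p_i^(1)`,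
`q_i ↦ q_i^(1) (x₁₁^(0) x₀₀^(1))^i q_i^(0)`. -/
def betaGen : Gen.{u} → Copower (Fin 2) RSemigroup.{u}
  | .x00 => cp 0 .x00
  | .x11 => cp 1 .x11
  | .p i => cp 0 (.p i) * powMul (cp 1 .x00 * cp 0 .x11) i (cp 1 (.p i))
  | .q i => cp 1 (.q i) * powMul (cp 0 .x11 * cp 1 .x00) i (cp 0 (.q i))

/-- The co-operation `β^R : R → R ∐ R`. -/
def beta : RSemigroup.{u} →ₙ* Copower (Fin 2) RSemigroup.{u} :=
  Presented.lift betaGen (by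
    rintro _ _ (_ | _ | i | i | i | i) <;>
      simp only [map_mul, FreeSemigroup.lift_of, betaGen, cp]
    · rw [← map_mul, x00_x00]
    · rw [← map_mul, x11_x11]
    · rw [← mul_assoc, ← map_mul, x00_p]
    · rw [mul_assoc, powMul_mul, ← map_mul (Copower.inj 1) (gen (.p i)), p_x11]
    · rw [← mul_assoc, ← map_mul, x11_q]
    · rw [mul_assoc, powMul_mul, ← map_mul (Copower.inj 0) (gen (.q i)), q_x00])

theorem beta_gen (x : Gen.{u}) : beta (gen x) = betaGen x := Presented.lift_of _ _ _

theorem coassociative_beta : Coassociative beta.{u} := by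
  refine Presented.hom_ext fun x => ?_
  change conv _ _ _ (gen x) = conv _ _ _ (gen x)
  cases x <;>
    simp [conv, beta_gen, betaGen, cp, map_powMul, Copower.desc_inj, mul_assoc, powMul_mul]

/-- The cosemigroup `R`. -/
def R : Cosemigroup.{u} where
  carrier := RSemigroup
  comul := beta
  coassoc := coassociative_beta

/-! ### The functor `E` -/

/-- The set of tuples `(a; b; c₀, c₁, …; d₀, d₁, …)` of elements of `A` with `a² = a`, `b² = b`,
`a c_i = c_i = c_i b` and `b d_i = d_i = d_i a`. -/
@[ext]
structure Tuple (A : Type u) [Semigroup A] : Type u where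
  a : A
  b : A
  c : ℕ → A
  d : ℕ → A
  a_mul_a : a * a = a
  b_mul_b : b * b = b
  a_mul_c (i : ℕ) : a * c i = c i
  c_mul_b (i : ℕ) : c i * b = c i
  b_mul_d (i : ℕ) : b * d i = d i
  d_mul_a (i : ℕ) : d i * a = d i

/-- The product of tuples `t` and `t'` is
`(a; b'; …, c_i (a' b)^i c'_i, …; …, d'_i (b a')^i d_i, …)`. -/
instance (A : Type u) [Semigroup A] : Semigroup (Tuple A) where
  mul t t' :=
    { a := t.a
      b := t'.b
      c := fun i => t.c i * powMul (t'.a * t.b) i (t'.c i)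
      d := fun i => t'.d i * powMul (t.b * t'.a) i (t.d i)
      a_mul_a := t.a_mul_a
      b_mul_b := t'.b_mul_b
      a_mul_c := fun i => by rw [← mul_assoc, t.a_mul_c]
      c_mul_b := fun i => by rw [mul_assoc, powMul_mul, t'.c_mul_b]
      b_mul_d := fun i => by rw [← mul_assoc, t'.b_mul_d]
      d_mul_a := fun i => by rw [mul_assoc, powMul_mul, t.d_mul_a] }
  mul_assoc t t' t'' := by
    refine Tuple.ext rfl rfl (funext fun i => ?_) (funext fun i => ?_)
    · change (t.c i * powMul (t'.a * t.b) i (t'.c i)) * powMul (t''.a * t'.b) i (t''.c i) =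
        t.c i * powMul (t'.a * t.b) i (t'.c i * powMul (t''.a * t'.b) i (t''.c i))
      rw [mul_assoc, powMul_mul]
    · change t''.d i * powMul (t'.b * t''.a) i (t'.d i * powMul (t.b * t'.a) i (t.d i)) =
        (t''.d i * powMul (t'.b * t''.a) i (t'.d i)) * powMul (t.b * t'.a) i (t.d i)
      rw [mul_assoc, powMul_mul]

/-- The functor `E`, applying homomorphisms to each coordinate of a tuple. -/
def E : Semigrp.{u} ⥤ Semigrp.{u} where
  obj A := Semigrp.of (Tuple A)
  map {A B} k := Semigrp.ofHom (X := Tuple A) (Y := Tuple B)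
    { toFun := fun t =>
        { a := k.hom t.a
          b := k.hom t.b
          c := fun i => k.hom (t.c i)
          d := fun i => k.hom (t.d i)
          a_mul_a := by rw [← map_mul, t.a_mul_a]
          b_mul_b := by rw [← map_mul, t.b_mul_b]
          a_mul_c := fun i => by rw [← map_mul, t.a_mul_c]
          c_mul_b := fun i => by rw [← map_mul, t.c_mul_b]
          b_mul_d := fun i => by rw [← map_mul, t.b_mul_d]
          d_mul_a := fun i => by rw [← map_mul, t.d_mul_a] }
      map_mul' := fun t t' => by
        refine Tuple.ext rfl rfl (funext fun i => ?_) (funext fun i => ?_)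
        · exact (map_mul k.hom _ _).trans (by rw [map_powMul, map_mul]; rfl)
        · exact (map_mul k.hom _ _).trans (by rw [map_powMul, map_mul]; rfl) }

/-- The tuple of images of the generators under a homomorphism `R → A`. -/
def evalGen {A : Type u} [Semigroup A] (f : R.{u}.Points A) : Tuple A :=
  let g : RSemigroup.{u} →ₙ* A := f
  { a := g (gen .x00)
    b := g (gen .x11)
    c := fun i => g (gen (.p i))
    d := fun i => g (gen (.q i))
    a_mul_a := by rw [← map_mul, x00_x00]
    b_mul_b := by rw [← map_mul, x11_x11]
    a_mul_c := fun i => by rw [← map_mul, x00_p]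
    c_mul_b := fun i => by rw [← map_mul, p_x11]
    b_mul_d := fun i => by rw [← map_mul, x11_q]
    d_mul_a := fun i => by rw [← map_mul, q_x00] }

end FinalCosemigroup

/-! Letters are idempotent in `Word α`, the free semigroup on idempotents indexed by `α`. So the
constant map to a letter is a homomorphism from any semigroup `A`, and a co-operation on `A`
multiplies such maps. The product 0·1·2 (`shape`) is thus a homomorphism `A → Word (Fin 3)`, natural
for cosemigroup morphisms.

Its values are very restricted. A constant map is idempotent under the product, so merging any two
neighbouring letters turns 0·1·2·3 into 0·1·2. Hence each value of `shape` has a lift to four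
letters with three prescribed images (`isLift_shape`). By `IsLift.cases_zero` and its mirror image,
words with such a lift are assembled from 0, 2, (01)^(i+1)(21)^i 2 and (21)^(i+1)(01)^i 0. These are
the images of `x00`, `x11`, `p_i`, `q_i` under `shapeR`. Normal forms (`Code`) show that `shapeR` is
injective on `R`, so `shape` factors uniquely through it; the factor is `toR`. Naturality of `shape`
gives uniqueness of morphisms to `R`.

For compatibility of `toR` with the co-operations, `R ∐ R` is embedded in the words on six letters
(`desc_shapeR_injective`). Such a word is determined by four of its merges to three letters
(`Word.eq_of_merge_eq`), and each of these turns the product of six letters back into 0·1·2, where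
agreement holds by construction.

For the initiality of `E`, the Yoneda lemma translates natural transformations out of `E` into
cosemigroup morphisms to `R`. -/

namespace FinalCosemigroup

/-! ### Words without equal adjacent letters -/

section Push

variable {α β γ : Type*} [DecidableEq β]

/-- Put a letter in front of a list, unless the list already starts with it. -/
def push [DecidableEq α] (a : α) (l : List α) : List α :=
  if l.head? = some a then l else a :: l

theorem head?_push [DecidableEq α] (a : α) (l : List α) : (push a l).head? = some a := by
  unfold push
  split_ifs with h
  · exact h
  · rfl

theorem push_push [DecidableEq α] (a : α) (l : List α) : push a (push a l) = push a l := by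
  rw [push, if_pos (head?_push a l)]

theorem push_ne_nil [DecidableEq α] (a : α) (l : List α) : push a l ≠ [] := by
  intro h
  simpa [h] using head?_push a l

theorem push_cons_self [DecidableEq α] (a : α) (l : List α) : push a (a :: l) = a :: l := by
  simp [push]

theorem push_cons_of_ne [DecidableEq α] {a b : α} (h : a ≠ b) (l : List α) :
    push a (b :: l) = a :: b :: l := by
  simp [push, h.symm]

theorem isChain_push [DecidableEq α] (a : α) {l : List α} (hl : l.IsChain (· ≠ ·)) :
    (push a l).IsChain (· ≠ ·) := by
  unfold push
  split_ifs with h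
  · exact hl
  · refine List.isChain_cons.2 ⟨?_, hl⟩
    rintro b hb rfl
    exact h hb

/-- Push the images of the letters of `l` onto `t`. -/
def pushAll (f : α → β) (l : List α) (t : List β) : List β :=
  l.foldr (fun a => push (f a)) t

theorem pushAll_cons (f : α → β) (a : α) (l : List α) (t : List β) :
    pushAll f (a :: l) t = push (f a) (pushAll f l t) := rfl

theorem pushAll_push [DecidableEq α] (f : α → β) (a : α) (l : List α) (t : List β) :
    pushAll f (push a l) t = push (f a) (pushAll f l t) := by
  by_cases h : l.head? = some a
  · rw [push, if_pos h]
    obtain ⟨l', rfl⟩ : ∃ l', l = a :: l' := by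
      cases l with
      | nil => simp at h
      | cons b l' => exact ⟨l', by simpa using h⟩
    rw [pushAll_cons, push_push]
  · rw [push, if_neg h, pushAll_cons]

/-- Equal neighbours have equal images, so merging early or late makes no difference. This yields
both associativity and functoriality of `Word`. -/
theorem pushAll_pushAll [DecidableEq γ] (f : α → β) (g : β → γ) (l : List α) (t : List β)
    (s : List γ) :
    pushAll g (pushAll f l t) s = pushAll (g ∘ f) l (pushAll g t s) := by
  induction l with
  | nil => rfl
  | cons a l ih => rw [pushAll_cons, pushAll_push, ih]; rfl

theorem isChain_pushAll (f : α → β) (l : List α) {t : List β} (ht : t.IsChain (· ≠ ·)) :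
    (pushAll f l t).IsChain (· ≠ ·) := by
  induction l with
  | nil => exact ht
  | cons a l ih => exact isChain_push _ ih

theorem pushAll_ne_nil (f : α → β) {l : List α} (hl : l ≠ []) (t : List β) :
    pushAll f l t ≠ [] := by
  cases l with
  | nil => exact absurd rfl hl
  | cons a l => exact push_ne_nil _ _

theorem push_of_isChain_cons [DecidableEq α] {a : α} {l : List α} (h : (a :: l).IsChain (· ≠ ·)) :
    push a l = a :: l := by
  rw [push, if_neg]
  intro h'
  exact (List.isChain_cons.1 h).1 a h' rfl

/-- If no letters merge, `pushAll` is concatenation. -/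
theorem pushAll_eq_map_append {f : α → β} {l : List α} {t : List β}
    (h : (l.map f ++ t).IsChain (· ≠ ·)) : pushAll f l t = l.map f ++ t := by
  induction l with
  | nil => rfl
  | cons a l ih =>
    rw [pushAll_cons, ih (List.IsChain.of_cons h)]
    exact push_of_isChain_cons h

/-- The reduced word of the images under `f` of the letters of a word. -/
def red (f : α → β) (l : List α) : List β := pushAll f l []

theorem red_nil (f : α → β) : red f [] = [] := rfl

theorem red_cons (f : α → β) (a : α) (l : List α) : red f (a :: l) = push (f a) (red f l) := rfl

theorem head?_red (f : α → β) (l : List α) : (red f l).head? = l.head?.map f := by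
  cases l with
  | nil => rfl
  | cons a l => exact head?_push _ _

theorem red_cons_cons_of_eq {f : α → β} {a b : α} (h : f a = f b) (l : List α) :
    red f (a :: b :: l) = red f (b :: l) := by
  rw [red_cons, red_cons, h, push_push]

theorem red_cons_of_ne {f : α → β} {a : α} {l : List α} (h : ∀ b ∈ l.head?, f a ≠ f b) :
    red f (a :: l) = f a :: red f l := by
  rw [red_cons, push, if_neg]
  rw [head?_red]
  intro h'
  obtain ⟨b, hb, hba⟩ := Option.map_eq_some_iff.1 h'
  exact h b hb hba.symm

theorem red_cons_cons_of_ne {f : α → β} {a b : α} (h : f a ≠ f b) (l : List α) :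
    red f (a :: b :: l) = f a :: red f (b :: l) :=
  red_cons_of_ne (by simpa using h)

/-- A letter alone in its fibre differs from its successor even after applying `f`, so it cannot
merge. -/
theorem red_cons_of_unique {f : α → β} {a : α} {l : List α} (hl : (a :: l).IsChain (· ≠ ·))
    (h : ∀ b, f b = f a → b = a) : red f (a :: l) = f a :: red f l :=
  red_cons_of_ne fun b hb hab => (List.isChain_cons.1 hl).1 b hb (h b hab.symm).symm

theorem exists_cons_of_red_eq_cons {f : α → β} {l : List α} {b : β} {t : List β}
    (h : red f l = b :: t) : ∃ a l', l = a :: l' ∧ f a = b := by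
  cases l with
  | nil => exact absurd h (by simp [red_nil])
  | cons a l' =>
    refine ⟨a, l', rfl, ?_⟩
    have := head?_red f (a :: l')
    rw [h] at this
    simpa using this.symm

theorem exists_red_cons (f : α → β) (a : α) (l : List α) : ∃ t, red f (a :: l) = f a :: t := by
  have h := head?_red f (a :: l)
  cases hr : red f (a :: l) with
  | nil => simp [hr] at h
  | cons b t => exact ⟨t, by simpa [hr] using h⟩

/-- The word `(a b)^n` followed by `t`. -/
def alt (a b : α) : ℕ → List α → List α
  | 0, t => t
  | n + 1, t => a :: b :: alt a b n t

theorem alt_succ' (a b : α) (n : ℕ) (t : List α) :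
    alt a b (n + 1) t = alt a b n (a :: b :: t) := by
  induction n with
  | zero => rfl
  | succ n ih => rw [alt, ih]; rfl

end Push

/-! ### Words on three letters that lift to words on four letters -/

section Alt

variable {α β : Type*} [DecidableEq β]

theorem alt_injective (a b : α) (n : ℕ) : Function.Injective (alt a b n) := by
  induction n with
  | zero => exact fun _ _ h => h
  | succ n ih => exact fun s t h => ih (by simpa [alt] using h)

theorem red_alt_of_ne {f : α → β} {a b : α} (h : f a ≠ f b) (n : ℕ) (l : List α) :
    red f (alt a b n (a :: l)) = alt (f a) (f b) n (red f (a :: l)) := by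
  induction n with
  | zero => rfl
  | succ n ih =>
    rw [alt, alt, red_cons_cons_of_ne h, ← ih]
    cases n with
    | zero => rw [alt, red_cons_cons_of_ne h.symm]
    | succ n => rw [alt, red_cons_cons_of_ne h.symm]

theorem red_alt_of_eq {f : α → β} {a b : α} (h : f a = f b) (n : ℕ) (l : List α) :
    red f (alt a b n (a :: l)) = red f (a :: l) := by
  induction n with
  | zero => rfl
  | succ n ih =>
    rw [alt, red_cons_cons_of_eq h, ← ih]
    cases n with
    | zero => rw [alt, red_cons_cons_of_eq h.symm]
    | succ n => rw [alt, red_cons_cons_of_eq h.symm]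

/-- Letters alone in their fibres neither merge nor hide another letter, so the prefix can be read
off the image letter by letter. -/
theorem exists_eq_alt_of_red_eq_alt {f : α → β} {a b : α} (ha : ∀ c, f c = f a → c = a)
    (hb : ∀ c, f c = f b → c = b) (n : ℕ) {l : List α} (hl : l.IsChain (· ≠ ·)) {t : List β}
    (h : red f l = alt (f a) (f b) n t) :
    ∃ l', l = alt a b n l' ∧ l'.IsChain (· ≠ ·) ∧ red f l' = t := by
  induction n generalizing l with
  | zero => exact ⟨l, rfl, hl, h⟩
  | succ n ih =>
    rw [alt] at h
    obtain ⟨c, l₁, rfl, hc⟩ := exists_cons_of_red_eq_cons h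
    obtain rfl := ha c hc
    rw [red_cons_of_unique hl ha, List.cons_inj_right] at h
    obtain ⟨d, l₂, rfl, hd⟩ := exists_cons_of_red_eq_cons h
    obtain rfl := hb d hd
    rw [red_cons_of_unique hl.of_cons hb, List.cons_inj_right] at h
    obtain ⟨l', rfl, hl', h'⟩ := ih hl.of_cons.of_cons h
    exact ⟨l', rfl, hl', h'⟩

end Alt

/-- A reduced word on four letters each of whose images, under the merging of two neighbouring
letters, is the given word on three letters. -/
structure IsLift (v : List (Fin 4)) (w : List (Fin 3)) : Prop where
  isChain : v.IsChain (· ≠ ·)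
  merge₀₁ : red ![0, 0, 1, 2] v = w
  merge₁₂ : red ![0, 1, 1, 2] v = w
  merge₂₃ : red ![0, 1, 2, 2] v = w

theorem red_map_rev {m n : ℕ} (f : Fin m → Fin n) (l : List (Fin m)) :
    red f (l.map Fin.rev) = (red (Fin.rev ∘ f ∘ Fin.rev) l).map Fin.rev := by
  induction l with
  | nil => rfl
  | cons a l ih =>
    rw [List.map_cons, red_cons, red_cons, ih, push, push]
    simp only [List.head?_map, Function.comp_apply]
    by_cases h : (red (Fin.rev ∘ f ∘ Fin.rev) l).head? = some (f a.rev).rev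
    · rw [if_pos h, if_pos (by simp [h])]
    · rw [if_neg h, if_neg, List.map_cons, Fin.rev_rev]
      intro h'
      obtain ⟨b, hb, hb'⟩ := Option.map_eq_some_iff.1 h'
      exact h (by rw [hb, ← hb', Fin.rev_rev])

theorem map_rev_rev {n : ℕ} (l : List (Fin n)) : (l.map Fin.rev).map Fin.rev = l := by
  simp [Function.comp_def]

/-- Reversing the alphabet (not the word) exchanges the two outer merges and fixes the middle one.
It makes words starting with 2 a mirror image of those starting with 0. -/
theorem IsLift.rev {v : List (Fin 4)} {w : List (Fin 3)} (h : IsLift v w) :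
    IsLift (v.map Fin.rev) (w.map Fin.rev) where
  isChain := by
    rw [List.isChain_map]
    exact h.isChain.imp fun _ _ hab => fun h' => hab (Fin.rev_injective h')
  merge₀₁ := by
    rw [red_map_rev, ← h.merge₂₃]
    congr 2
    decide
  merge₁₂ := by
    rw [red_map_rev, ← h.merge₁₂]
    congr 2
    decide
  merge₂₃ := by
    rw [red_map_rev, ← h.merge₀₁]
    congr 2
    decide

theorem IsLift.tail {v : List (Fin 4)} {w : List (Fin 3)} (h : IsLift (0 :: 3 :: v) (0 :: w)) :
    IsLift (3 :: v) w where
  isChain := h.isChain.of_cons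
  merge₀₁ := by
    simpa using (red_cons_cons_of_ne (f := ![0, 0, 1, 2]) (by decide) v).symm.trans h.merge₀₁
  merge₁₂ := by
    simpa using (red_cons_cons_of_ne (f := ![0, 1, 1, 2]) (by decide) v).symm.trans h.merge₁₂
  merge₂₃ := by
    simpa using (red_cons_cons_of_ne (f := ![0, 1, 2, 2]) (by decide) v).symm.trans h.merge₂₃

/-- The exponent is maximal: the remainder never begins with 0 1. -/
theorem exists_eq_alt_of_isChain {w : List (Fin 3)} (hw : w.IsChain (· ≠ ·))
    (h1 : w.head? ≠ some 1) :
    ∃ k t, w = alt 0 1 k t ∧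
      (t = [] ∨ t = [0] ∨ (∃ t', t = 0 :: 2 :: t') ∨ ∃ t', t = 2 :: t') := by
  match w with
  | [] => exact ⟨0, _, rfl, .inl rfl⟩
  | 2 :: t' => exact ⟨0, _, rfl, .inr (.inr (.inr ⟨t', rfl⟩))⟩
  | 1 :: _ => exact absurd rfl h1
  | [0] => exact ⟨0, _, rfl, .inr (.inl rfl)⟩
  | 0 :: 0 :: _ => exact absurd hw (by simp)
  | 0 :: 2 :: t' => exact ⟨0, _, rfl, .inr (.inr (.inl ⟨t', rfl⟩))⟩
  | 0 :: 1 :: w' =>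
    obtain ⟨k, t, rfl, ht⟩ := exists_eq_alt_of_isChain hw.of_cons.of_cons
      (fun h => (List.isChain_cons.1 hw.of_cons).1 1 h rfl)
    exact ⟨k + 1, t, rfl, ht⟩

/-- The shape of the second third of a lift of a word starting with `(0 1)^(i + 1) 2`. -/
theorem exists_eq_alt_of_red_of_red (i : ℕ) {w : List (Fin 3)} {v : List (Fin 4)}
    (hv : (2 :: v).IsChain (· ≠ ·))
    (h₀₁ : red ![(0 : Fin 3), 0, 1, 2] (2 :: v) = 1 :: alt 0 1 i (2 :: w))
    (h₁₂ : red ![(0 : Fin 3), 1, 1, 2] (2 :: v) = 1 :: 2 :: w) :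
    ∃ z, 2 :: v = alt 2 1 i (2 :: 3 :: z) ∧ (3 :: z).IsChain (· ≠ ·) ∧
      red ![(0 : Fin 3), 0, 1, 2] (3 :: z) = 2 :: w ∧
      red ![(0 : Fin 3), 1, 1, 2] (3 :: z) = 2 :: w := by
  have head (f : Fin 4 → Fin 3) (c : Fin 4) (l : List (Fin 4)) (b : Fin 3) (t : List (Fin 3))
      (h : red f (c :: l) = b :: t) : f c = b := by
    obtain ⟨a, l', hl, ha⟩ := exists_cons_of_red_eq_cons h
    rw [List.cons_eq_cons] at hl
    rw [hl.1, ha]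
  -- The merge of 1 and 2 allows only the letters 1 and 2 before the first 3, so they alternate; the
  -- merge of 0 and 1 keeps them distinct and so counts them.
  cases v with
  | nil => cases h₁₂
  | cons c v =>
  have hc0 : c ≠ 0 := by
    rintro rfl
    rw [red_cons_cons_of_ne (by decide)] at h₁₂
    exact absurd (head _ _ _ _ _ (List.cons_eq_cons.1 h₁₂).2) (by decide)
  have hc2 : c ≠ 2 := by
    rintro rfl
    simp at hv
  have hne : (![0, 0, 1, 2] : Fin 4 → Fin 3) 2 ≠ (![0, 0, 1, 2] : Fin 4 → Fin 3) c := by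
    clear * - hc0 hc2
    revert c; decide
  rw [red_cons_cons_of_ne hne, List.cons_eq_cons] at h₀₁
  replace h₀₁ := h₀₁.2
  cases i with
  | zero =>
    have hc3 : c = 3 := by
      have := head _ _ _ _ _ h₀₁
      clear * - hc0 hc2 this
      revert c; decide
    subst hc3
    rw [red_cons_cons_of_ne (by decide), List.cons_eq_cons] at h₁₂
    exact ⟨v, rfl, hv.of_cons, h₀₁, h₁₂.2⟩
  | succ i =>
    have hc1 : c = 1 := by
      have := head _ _ _ _ _ h₀₁
      clear * - hc0 hc2 this
      revert c; decide
    subst hc1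
    rw [red_cons_cons_of_eq (by decide)] at h₁₂
    cases v with
    | nil => cases h₁₂
    | cons d v =>
    have hd0 : d ≠ 0 := by
      rintro rfl
      rw [red_cons_cons_of_ne (by decide)] at h₁₂
      exact absurd (head _ _ _ _ _ (List.cons_eq_cons.1 h₁₂).2) (by decide)
    have hd1 : d ≠ 1 := by
      rintro rfl
      simp at hv
    have hne : (![0, 0, 1, 2] : Fin 4 → Fin 3) 1 ≠ (![0, 0, 1, 2] : Fin 4 → Fin 3) d := by
      clear * - hd0 hd1
      revert d; decide
    rw [red_cons_cons_of_ne hne, alt, List.cons_eq_cons] at h₀₁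
    replace h₀₁ := h₀₁.2
    have hd2 : d = 2 := by
      have := head _ _ _ _ _ h₀₁
      clear * - hd0 hd1 this
      revert d; decide
    subst hd2
    rw [red_cons_cons_of_eq (by decide)] at h₁₂
    obtain ⟨z, hz, hz', hz''⟩ := exists_eq_alt_of_red_of_red i hv.of_cons.of_cons h₀₁ h₁₂
    exact ⟨z, by rw [alt, hz], hz', hz''⟩

/-- A word starting with `0` that lifts to four letters is a single letter or factors. -/
theorem IsLift.cases_zero {v : List (Fin 4)} {w : List (Fin 3)} (h : IsLift v (0 :: w)) :
    w = [] ∨ (∃ w' v', w = 2 :: w' ∧ IsLift v' (2 :: w')) ∨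
      ∃ i w' v', 0 :: w = alt 0 1 (i + 1) (alt 2 1 i (2 :: w')) ∧ IsLift v' (2 :: w') := by
  have hw : (0 :: w).IsChain (· ≠ ·) := by
    rw [← h.merge₀₁]
    exact isChain_pushAll _ _ List.IsChain.nil
  obtain ⟨k, t, hk, ht⟩ := exists_eq_alt_of_isChain hw (by simp)
  obtain ⟨hv, h₀₁, h₁₂, h₂₃⟩ := h
  have key := hk
  rw [key] at h₂₃
  -- The merge of 2 and 3 leaves 0 and 1 alone in their fibres, so the prefix (01)^k lifts to
  -- itself.
  obtain ⟨v, rfl, hv', g₂₃⟩ := exists_eq_alt_of_red_eq_alt (f := (![0, 1, 2, 2] : Fin 4 → Fin 3))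
    (a := 0) (b := 1) (by decide) (by decide) k hv h₂₃
  -- For `k > 0` the merge of 0 and 1 contracts the prefix (01)^k to a single 0. Comparing with the
  -- other merges leaves one possibility for each of the three outcomes.
  rcases ht with rfl | rfl | ⟨t, rfl⟩ | ⟨t, rfl⟩
  · cases v with
    | cons a v => exact absurd g₂₃ (push_ne_nil _ _)
    | nil =>
    cases k with
    | zero => cases hk
    | succ k =>
      rw [alt_succ', red_alt_of_eq (by decide), hk] at h₀₁
      cases h₀₁
  · obtain ⟨a, v, rfl, ha⟩ := exists_cons_of_red_eq_cons g₂₃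
    have ha : a = 0 := by clear * - ha; revert a; decide
    subst ha
    have : v = [] := by
      rw [red_cons_of_unique hv' (by decide)] at g₂₃
      cases v with
      | nil => rfl
      | cons a v => exact absurd (List.cons_eq_cons.1 g₂₃).2 (push_ne_nil _ _)
    subst this
    cases k with
    | zero => exact .inl (by simpa [alt] using hk)
    | succ k =>
      rw [red_alt_of_eq (by decide), hk] at h₀₁
      cases h₀₁
  · obtain ⟨a, v, rfl, ha⟩ := exists_cons_of_red_eq_cons g₂₃
    have ha : a = 0 := by clear * - ha; revert a; decide
    subst ha
    rw [red_cons_of_unique hv' (by decide), List.cons_eq_cons] at g₂₃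
    obtain ⟨c, v, rfl, hc⟩ := exists_cons_of_red_eq_cons g₂₃.2
    rw [red_alt_of_eq (by decide), hk] at h₀₁
    have hc' : c = 2 ∨ c = 3 := by clear * - hc; revert c; decide
    cases k with
    | zero =>
      rcases hc' with rfl | rfl
      · rw [red_cons_cons_of_ne (by decide), alt, List.cons_eq_cons] at h₀₁
        obtain ⟨_, _⟩ := exists_red_cons (![0, 0, 1, 2] : Fin 4 → Fin 3) 2 v
        simp_all
      · refine .inr (.inl ⟨t, 3 :: v, by simpa [alt] using hk, IsLift.tail ⟨hv, ?_, ?_, ?_⟩⟩)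
        · rw [h₀₁]; rfl
        · rw [← alt.eq_1 0 1 (0 :: 3 :: v), h₁₂, hk]; rfl
        · rw [red_cons_cons_of_ne (by decide), g₂₃.2]; rfl
    | succ k =>
      rcases hc' with rfl | rfl
      · rw [red_alt_of_ne (by decide), hk] at h₁₂
        have := alt_injective _ _ _ h₁₂
        rw [red_cons_cons_of_ne (by decide), List.cons_eq_cons] at this
        obtain ⟨_, _⟩ := exists_red_cons (![0, 1, 1, 2] : Fin 4 → Fin 3) 2 v
        simp_all
      · rw [red_cons_cons_of_ne (by decide), alt, List.cons_eq_cons] at h₀₁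
        obtain ⟨_, _⟩ := exists_red_cons (![0, 0, 1, 2] : Fin 4 → Fin 3) 3 v
        simp_all
  · cases k with
    | zero => simp [alt] at hk
    | succ i =>
    obtain ⟨c, v, rfl, hc⟩ := exists_cons_of_red_eq_cons g₂₃
    have hc' : c = 2 ∨ c = 3 := by clear * - hc; revert c; decide
    rw [alt_succ', red_alt_of_eq (by decide), hk, red_cons_cons_of_eq (by decide)] at h₀₁
    have hc2 : c = 2 := by
      rcases hc' with rfl | rfl
      · rfl
      · rw [red_cons_cons_of_ne (by decide), alt, List.cons_eq_cons] at h₀₁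
        obtain ⟨_, _⟩ := exists_red_cons (![0, 0, 1, 2] : Fin 4 → Fin 3) 3 v
        simp_all
    subst hc2
    rw [red_cons_cons_of_ne (by decide), alt, List.cons_eq_cons] at h₀₁
    rw [alt_succ', red_alt_of_ne (by decide), hk, alt_succ'] at h₁₂
    have h₁₂ := alt_injective _ _ _ h₁₂
    rw [red_cons_cons_of_ne (by decide), red_cons_cons_of_eq (by decide),
      List.cons_eq_cons] at h₁₂
    -- The whole lift turns out to be (01)^(i+1) (21)^i 2 (32)^i followed by a lift of the remaining
    -- word.
    obtain ⟨z, hz, hzc, hz₀₁, hz₁₂⟩ := exists_eq_alt_of_red_of_red i hv' h₀₁.2 h₁₂.2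
    obtain ⟨y, hy⟩ := exists_red_cons (![0, 1, 2, 2] : Fin 4 → Fin 3) 3 z
    have ht : 2 :: t = alt 2 1 i (2 :: y) := by
      rw [← g₂₃, hz, red_alt_of_ne (by decide), red_cons_cons_of_eq (by decide), hy]
      rfl
    rw [ht] at hz₀₁ hz₁₂
    -- Now 3 and 2 are alone in their fibres, so (21)^i can only come from (32)^i.
    obtain ⟨x, hx, hxc, hx₀₁⟩ := exists_eq_alt_of_red_eq_alt (f := (![0, 0, 1, 2] : Fin 4 → Fin 3))
      (a := 3) (b := 2) (by decide) (by decide) i hzc hz₀₁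
    obtain ⟨a, x, rfl, ha⟩ := exists_cons_of_red_eq_cons hx₀₁
    have ha : a = 3 := by clear * - ha; revert a; decide
    subst ha
    refine .inr (.inr ⟨i, y, 3 :: x, by rw [hk, ht], hxc, hx₀₁, ?_, ?_⟩)
    · rw [hx, red_alt_of_ne (by decide)] at hz₁₂
      exact alt_injective _ _ _ hz₁₂
    · rw [hx, red_alt_of_eq (by decide)] at hy
      exact hy

/-! ### Normal forms in `R` -/

theorem map_alt {α β : Type*} (f : α → β) (a b : α) (n : ℕ) (t : List α) :
    (alt a b n t).map f = alt (f a) (f b) n (t.map f) := by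
  induction n with
  | zero => rfl
  | succ n ih => simp [alt, ih]

theorem alt_inj {α : Type*} {a b : α} {m n : ℕ} {s t : List α} (hs : s.head? ≠ some a)
    (ht : t.head? ≠ some a) (h : alt a b m s = alt a b n t) : m = n ∧ s = t := by
  induction m generalizing n with
  | zero =>
    cases n with
    | zero => exact ⟨rfl, h⟩
    | succ n => exact absurd (by rw [show s = _ from h]; rfl) hs
  | succ m ih =>
    cases n with
    | zero => exact absurd (by rw [show t = _ from h.symm]; rfl) ht
    | succ n =>
      obtain ⟨rfl, rfl⟩ := ih (n := n) (by simpa [alt] using h)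
      exact ⟨rfl, rfl⟩

/-- The idempotent generators. -/
def idemGen (b : Bool) : RSemigroup.{u} := gen (bif b then .x11 else .x00)

/-- The generators that are not idempotent. -/
def arrowGen (b : Bool) (i : ℕ) : RSemigroup.{u} := gen (bif b then .q i else .p i)

theorem idemGen_mul_self (b : Bool) : idemGen.{u} b * idemGen b = idemGen b := by
  cases b
  exacts [x00_x00, x11_x11]

theorem idemGen_mul_arrowGen (b : Bool) (i : ℕ) :
    idemGen.{u} b * arrowGen b i = arrowGen b i := by
  cases b
  exacts [x00_p i, x11_q i]

theorem arrowGen_mul_idemGen (b : Bool) (i : ℕ) :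
    arrowGen.{u} b i * idemGen (!b) = arrowGen b i := by
  cases b
  exacts [p_x11 i, q_x00 i]

/-- The outer letter of the alphabet `0, 1, 2` on a given side. -/
def side (b : Bool) : Fin 3 := bif b then 2 else 0

theorem side_inj {b b' : Bool} : side b = side b' ↔ b = b' := by
  revert b b'; decide

theorem side_ne_one (b : Bool) : side b ≠ 1 := by
  revert b; decide

theorem side_not_ne (b : Bool) : side (!b) ≠ side b := by
  revert b; decide

theorem rev_side (b : Bool) : (side b).rev = side (!b) := by
  revert b; decide

/-- The word of an element `arrowGen b i * r`, where `t` is the word of `r`. -/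
def arrowWord (b : Bool) (i : ℕ) (t : List (Fin 3)) : List (Fin 3) :=
  alt (side b) 1 (i + 1) (alt (side (!b)) 1 i t)

theorem arrowWord_eq_cons (b : Bool) (i : ℕ) (t : List (Fin 3)) :
    arrowWord b i t = side b :: 1 :: alt (side b) 1 i (alt (side (!b)) 1 i t) := rfl

theorem head?_alt_cons {α : Type*} (a b : α) (n : ℕ) (t : List α) :
    (alt a b n (a :: t)).head? = some a := by
  cases n <;> rfl

theorem arrowWord_inj {b : Bool} {i j : ℕ} {s t : List (Fin 3)}
    (h : arrowWord b i (side (!b) :: s) = arrowWord b j (side (!b) :: t)) : i = j ∧ s = t := by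
  have hne (n : ℕ) (t : List (Fin 3)) :
      (alt (side (!b)) 1 n (side (!b) :: t)).head? ≠ some (side b) := by
    rw [head?_alt_cons]
    simpa using side_not_ne b
  obtain ⟨hij, h'⟩ := alt_inj (hne i s) (hne j t) h
  obtain rfl : i = j := by omega
  exact ⟨rfl, by simpa using alt_injective _ _ _ h'⟩

/-- The relation between elements of `R`, in normal form, and words on three letters. -/
inductive Code : RSemigroup.{u} → List (Fin 3) → Prop
  | idem (b : Bool) : Code (idemGen b) [side b]
  | idem_mul (b : Bool) (r : RSemigroup) (t : List (Fin 3)) :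
      Code r (side (!b) :: t) → Code (idemGen b * r) (side b :: side (!b) :: t)
  | arrow_mul (b : Bool) (i : ℕ) (r : RSemigroup) (t : List (Fin 3)) :
      Code r (side (!b) :: t) → Code (arrowGen b i * r) (arrowWord b i (side (!b) :: t))

theorem Code.exists_side {r : RSemigroup.{u}} {t : List (Fin 3)} (h : Code r t) :
    ∃ b t', t = side b :: t' ∧ idemGen b * r = r := by
  cases h with
  | idem b => exact ⟨b, [], rfl, idemGen_mul_self b⟩
  | idem_mul b r t h => exact ⟨b, _, rfl, by rw [← mul_assoc, idemGen_mul_self]⟩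
  | arrow_mul b i r t h =>
    exact ⟨b, _, arrowWord_eq_cons b i _, by rw [← mul_assoc, idemGen_mul_arrowGen]⟩

/-- The word reveals its last construction step: a single letter is an idempotent, a second letter 1
announces a `p` or `q`, and any other second letter an idempotent factor. In the second case
`arrowWord_inj` recovers the index. -/
theorem Code.unique {r r' : RSemigroup.{u}} {t t' : List (Fin 3)} (h : Code r t)
    (h' : Code r' t') (ht : t = t') : r = r' := by
  induction h generalizing r' t' with
  | idem b =>
    cases h' with
    | idem b' => rw [side_inj.1 (List.cons_eq_cons.1 ht).1]
    | idem_mul b' r t h => simp at ht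
    | arrow_mul b' i r t h => simp [arrowWord_eq_cons] at ht
  | idem_mul b r t h ih =>
    cases h' with
    | idem b' => simp at ht
    | idem_mul b' r' t' h' =>
      obtain ⟨hb, ht⟩ := List.cons_eq_cons.1 ht
      obtain rfl := side_inj.1 hb
      rw [ih h' ht]
    | arrow_mul b' i r' t' h' =>
      rw [arrowWord_eq_cons, List.cons_eq_cons, List.cons_eq_cons] at ht
      exact absurd ht.2.1 (side_ne_one _)
  | arrow_mul b i r t h ih =>
    cases h' with
    | idem b' => simp [arrowWord_eq_cons] at ht
    | idem_mul b' r' t' h' =>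
      rw [arrowWord_eq_cons, List.cons_eq_cons, List.cons_eq_cons] at ht
      exact absurd ht.2.1.symm (side_ne_one _)
    | arrow_mul b' j r' t' h' =>
      have hb := ht
      rw [arrowWord_eq_cons, arrowWord_eq_cons, List.cons_eq_cons] at hb
      obtain rfl := side_inj.1 hb.1
      obtain ⟨rfl, rfl⟩ := arrowWord_inj ht
      rw [ih h' rfl]

/-- The idempotent is either absorbed by the first factor or becomes a new one. -/
theorem Code.exists_idemGen_mul {r : RSemigroup.{u}} {t : List (Fin 3)} (h : Code r t)
    (b : Bool) : ∃ t', Code (idemGen b * r) (side b :: t') := by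
  obtain ⟨b', t', rfl, hr⟩ := h.exists_side
  by_cases hb : b' = b
  · subst hb
    exact ⟨t', by rwa [hr]⟩
  · obtain rfl : b' = !b := Bool.eq_not.2 hb
    exact ⟨_, h.idem_mul⟩

theorem Code.exists_gen_mul {r : RSemigroup.{u}} {t : List (Fin 3)} (h : Code r t)
    (x : Gen.{u}) : ∃ t', Code (gen x * r) t' := by
  have arrow (b : Bool) (i : ℕ) : ∃ t', Code (arrowGen b i * r) t' := by
    obtain ⟨t', ht'⟩ := h.exists_idemGen_mul (!b)
    rw [← arrowGen_mul_idemGen, mul_assoc]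
    exact ⟨_, .arrow_mul b i _ _ ht'⟩
  cases x with
  | x00 => exact ⟨_, (h.exists_idemGen_mul false).choose_spec⟩
  | x11 => exact ⟨_, (h.exists_idemGen_mul true).choose_spec⟩
  | p i => exact arrow false i
  | q i => exact arrow true i

theorem exists_code_gen (x : Gen.{u}) : ∃ t, Code (gen x) t := by
  have arrow (b : Bool) (i : ℕ) : ∃ t, Code (arrowGen.{u} b i) t :=
    ⟨_, by simpa only [arrowGen_mul_idemGen] using (Code.idem (!b)).arrow_mul b i⟩
  cases x with
  | x00 => exact ⟨_, .idem false⟩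
  | x11 => exact ⟨_, .idem true⟩
  | p i => exact arrow false i
  | q i => exact arrow true i

theorem exists_code (r : RSemigroup.{u}) : ∃ t, Code r t := by
  obtain ⟨w, rfl⟩ := Presented.mk_surjective r
  induction w using FreeSemigroup.recOnMul with
  | ih1 x => exact exists_code_gen x
  | ih2 x y _ hy =>
    obtain ⟨t, ht⟩ := hy
    rw [map_mul]
    exact ht.exists_gen_mul x

theorem IsLift.cases_side {b : Bool} {v : List (Fin 4)} {w : List (Fin 3)}
    (h : IsLift v (side b :: w)) :
    w = [] ∨ (∃ w' v', w = side (!b) :: w' ∧ IsLift v' (side (!b) :: w')) ∨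
      ∃ i w' v', side b :: w = arrowWord b i (side (!b) :: w') ∧
        IsLift v' (side (!b) :: w') := by
  cases b with
  | false => exact h.cases_zero
  | true =>
    have hr := h.rev
    rw [List.map_cons, rev_side] at hr
    rcases IsLift.cases_zero hr with h0 | ⟨w', v', h1, hl⟩ | ⟨i, w', v', h1, hl⟩
    · exact .inl (List.map_eq_nil_iff.1 h0)
    · refine .inr (.inl ⟨w'.map Fin.rev, v'.map Fin.rev, ?_, hl.rev⟩)
      rw [← map_rev_rev w, h1]
      rfl
    · refine .inr (.inr ⟨i, w'.map Fin.rev, v'.map Fin.rev, ?_, hl.rev⟩)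
      have := congrArg (List.map Fin.rev) h1
      rw [map_alt, map_alt, List.map_cons, map_rev_rev] at this
      exact this

theorem IsLift.exists_code {v : List (Fin 4)} {w : List (Fin 3)} (h : IsLift v w)
    (hw : w ≠ []) : ∃ r : RSemigroup.{u}, Code r w := by
  induction hn : w.length using Nat.strong_induction_on generalizing v w with
  | _ n ih =>
  subst hn
  obtain ⟨a, w, rfl⟩ := List.exists_cons_of_ne_nil hw
  -- A first letter 1 would have to come from 2 under the merge of 0 and 1, but from 1 under the
  -- merge of 2 and 3.
  obtain ⟨b, rfl⟩ : ∃ b, a = side b := by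
    obtain ⟨c, _, rfl, h0⟩ := exists_cons_of_red_eq_cons h.merge₀₁
    have h1 := head?_red ![(0 : Fin 3), 1, 2, 2] (c :: ‹_›)
    rw [h.merge₂₃] at h1
    simp only [List.head?_cons, Option.map_some, Option.some.injEq] at h1
    clear * - h0 h1
    revert a c
    decide
  rcases h.cases_side with rfl | ⟨w', v', rfl, hl⟩ | ⟨i, w', v', hi, hl⟩
  · exact ⟨_, .idem b⟩
  · obtain ⟨r, hr⟩ := ih _ (by simp) hl (by simp) rfl
    exact ⟨_, hr.idem_mul⟩
  · have : w'.length < w.length := by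
      have := congrArg List.length hi
      have hlen (a b : Fin 3) (n : ℕ) (t : List (Fin 3)) :
          (alt a b n t).length = 2 * n + t.length := by
        induction n with
        | zero => simp [alt]
        | succ n ih => simp [alt, ih]; omega
      simp only [arrowWord, hlen, List.length_cons] at this
      omega
    obtain ⟨r, hr⟩ := ih _ (by simpa using this) hl (by simp) rfl
    exact hi ▸ ⟨_, .arrow_mul b i _ _ hr⟩

/-! ### The semigroup of reduced words -/

/-- The nonempty words without equal adjacent letters: the free semigroup on idempotents. -/
@[ext]
structure Word (α : Type*) where
  /-- The list of letters. -/
  toList : List α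
  isChain : toList.IsChain (· ≠ ·)
  ne_nil : toList ≠ []

namespace Word

variable {α β : Type*} [DecidableEq α] [DecidableEq β]

instance : Semigroup (Word α) where
  mul x y := ⟨pushAll id x.toList y.toList, isChain_pushAll _ _ y.isChain,
    pushAll_ne_nil _ x.ne_nil _⟩
  mul_assoc _ _ _ := Word.ext (pushAll_pushAll id id _ _ _)

/-- The word with a single letter. -/
def single (a : α) : Word α := ⟨[a], List.isChain_singleton a, List.cons_ne_nil _ _⟩

theorem toList_single_mul (a : α) (x : Word α) : (single a * x).toList = push a x.toList := rfl

theorem single_mul_self (a : α) : single a * single a = single a :=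
  Word.ext (push_cons_self a [])

/-- The homomorphism induced by a map of letters. -/
def map (f : α → β) : Word α →ₙ* Word β where
  toFun x := ⟨red f x.toList, isChain_pushAll _ _ List.IsChain.nil, pushAll_ne_nil _ x.ne_nil _⟩
  map_mul' x y := Word.ext <| by
    change pushAll f (pushAll id x.toList y.toList) [] =
      pushAll id (pushAll f x.toList []) (pushAll f y.toList [])
    rw [pushAll_pushAll, pushAll_pushAll]
    rfl

theorem toList_map (f : α → β) (x : Word α) : (map f x).toList = red f x.toList := rfl

theorem toList_map_of_injective {f : α → β} (hf : Function.Injective f) (x : Word α) :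
    (map f x).toList = x.toList.map f := by
  rw [toList_map, red, pushAll_eq_map_append, List.append_nil]
  rw [List.append_nil, List.isChain_map]
  exact x.isChain.imp fun _ _ hab h => hab (hf h)

theorem toList_powMul {a b : α} (hab : a ≠ b) (n : ℕ) (x : Word α)
    (hx : x.toList.head? = some a) :
    (powMul (single a * single b) n x).toList = alt a b n x.toList := by
  have hhead (n : ℕ) : (alt a b n x.toList).head? = some a := by
    cases n with
    | zero => exact hx
    | succ n => rfl
  induction n with
  | zero => rfl
  | succ n ih =>
    have hb : push b (alt a b n x.toList) = b :: alt a b n x.toList := by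
      rw [push, if_neg]
      simpa [hhead] using hab
    rw [powMul, mul_assoc, toList_single_mul, toList_single_mul, ih, hb, push_cons_of_ne hab]
    rfl

end Word

/-! ### The canonical homomorphisms to reduced words -/

section Letter

variable {α β : Type} [DecidableEq α] [DecidableEq β] {A : Type u} [Semigroup A]

/-- The constant homomorphism to an idempotent letter. -/
def letter (A : Type u) [Semigroup A] (a : α) : A →ₙ* Word α where
  toFun _ := Word.single a
  map_mul' _ _ := (Word.single_mul_self a).symm

theorem letter_apply (a : α) (x : A) : letter A a x = Word.single a := rfl

theorem map_comp_letter (f : α → β) (a : α) :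
    (Word.map f).comp (letter A a) = letter A (f a) := rfl

/-- Two equal constant maps induce a constant map on the copower, whatever the co-operation. -/
theorem conv_letter_self (β : A →ₙ* Copower (Fin 2) A) (a : α) :
    conv β (letter A a) (letter A a) = letter A a := by
  have : Copower.desc ![letter A a, letter A a] = letter (Copower (Fin 2) A) a :=
    Copower.hom_ext fun i x => by fin_cases i <;> exact Copower.desc_inj _ _ _
  rw [conv, this]
  rfl

/-- The product of three letters. -/
def shape (β : A →ₙ* Copower (Fin 2) A) (a b c : α) : A →ₙ* Word α :=
  conv β (letter A a) (conv β (letter A b) (letter A c))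

theorem map_comp_shape (β' : A →ₙ* Copower (Fin 2) A) (f : α → β) (a b c : α) :
    (Word.map f).comp (shape β' a b c) = shape β' (f a) (f b) (f c) := by
  simp only [shape, comp_conv, map_comp_letter]

end Letter

/-- Precomposition with a map respecting the co-operations preserves products of homomorphisms; this
is what makes `shape` natural. -/
theorem conv_comp {A B : Type u} [Semigroup A] [Semigroup B] {C : Type w} [Semigroup C]
    {α : A →ₙ* Copower (Fin 2) A} {β : B →ₙ* Copower (Fin 2) B} {h : A →ₙ* B}
    (hh : β.comp h = (Copower.map h).comp α) (f g : B →ₙ* C) :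
    (conv β f g).comp h = conv α (f.comp h) (g.comp h) := by
  have : (Copower.desc ![f, g]).comp (Copower.map h) = Copower.desc ![f.comp h, g.comp h] :=
    Copower.hom_ext fun i x => by
      fin_cases i <;> simp [Copower.map, Copower.desc_inj]
  rw [conv, conv, MulHom.comp_assoc, hh, ← MulHom.comp_assoc, this]

theorem shape_comp {A B : Type u} [Semigroup A] [Semigroup B]
    {α : A →ₙ* Copower (Fin 2) A} {β : B →ₙ* Copower (Fin 2) B} {h : A →ₙ* B}
    (hh : β.comp h = (Copower.map h).comp α) {ι : Type} [DecidableEq ι] (a b c : ι) :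
    (shape β a b c).comp h = shape α a b c := by
  rw [shape, conv_comp hh, conv_comp hh]
  rfl

/-- The lift is the value of 0·1·2·3: each merge repeats a letter, and coassociativity and
idempotence remove the repetition. -/
theorem isLift_shape {A : Type u} [Semigroup A] {β : A →ₙ* Copower (Fin 2) A}
    (hβ : Coassociative β) (x : A) :
    ∃ v, IsLift v (shape β (0 : Fin 3) 1 2 x).toList := by
  let g : A →ₙ* Word (Fin 4) := conv β (letter A 0) (shape β 1 2 3)
  have key (f : Fin 4 → Fin 3)
      (hf : conv β (letter A (f 0)) (shape β (f 1) (f 2) (f 3)) = shape β (0 : Fin 3) 1 2) :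
      red f (g x).toList = (shape β (0 : Fin 3) 1 2 x).toList := by
    rw [← hf, ← map_comp_letter, ← map_comp_shape, ← comp_conv]
    rfl
  refine ⟨(g x).toList, (g x).isChain, key _ ?_, key _ ?_, key _ ?_⟩
  · change conv β (letter A 0) (conv β (letter A 0) _) = _
    rw [← hβ.conv_assoc, conv_letter_self]
    rfl
  · change conv β (letter A 0) (conv β (letter A 1) (conv β (letter A 1) (letter A 2))) = _
    rw [← hβ.conv_assoc (letter A 1), conv_letter_self]
    rfl
  · change conv β (letter A 0) (conv β (letter A 1) (conv β (letter A 2) (letter A 2))) = _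
    rw [conv_letter_self]
    rfl

/-- The canonical homomorphism from `R` to reduced words on three letters. -/
abbrev shapeR : RSemigroup.{u} →ₙ* Word (Fin 3) := shape beta 0 1 2

theorem conv_beta_gen {B : Type w} [Semigroup B] (f g : RSemigroup.{u} →ₙ* B) (x : Gen.{u}) :
    conv beta f g (gen x) = match x with
      | .x00 => f (gen .x00)
      | .x11 => g (gen .x11)
      | .p i => f (gen (.p i)) * powMul (g (gen .x00) * f (gen .x11)) i (g (gen (.p i)))
      | .q i => g (gen (.q i)) * powMul (f (gen .x11) * g (gen .x00)) i (f (gen (.q i))) := by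
  cases x <;> simp [conv, beta_gen, betaGen, cp, map_powMul, Copower.desc_inj]

theorem shapeR_idemGen (b : Bool) : shapeR.{u} (idemGen b) = Word.single (side b) := by
  cases b with
  | false => exact conv_beta_gen _ _ _
  | true => exact (conv_beta_gen _ _ _).trans (conv_beta_gen _ _ _)

theorem shapeR_arrowGen (b : Bool) (i : ℕ) :
    shapeR.{u} (arrowGen b i) = Word.single (side b) *
      powMul (Word.single 1 * Word.single (side b)) i (Word.single 1 *
        powMul (Word.single (side (!b)) * Word.single 1) i (Word.single (side (!b)))) := by
  cases b with
  | false =>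
    refine (conv_beta_gen _ _ _).trans ?_
    change _ * powMul (conv _ _ _ _ * _) i (conv _ _ _ _) = _
    simp only [conv_beta_gen, letter_apply]
    rfl
  | true =>
    change conv _ _ _ _ = _
    -- With the bracketing (0·1)·2 the computation for `q` mirrors that for `p`.
    rw [← coassociative_beta.conv_assoc]
    refine (conv_beta_gen _ _ _).trans ?_
    change _ * powMul (conv _ _ _ _ * _) i (conv _ _ _ _) = _
    simp only [conv_beta_gen, letter_apply]
    rfl

theorem push_alt_swap {α : Type*} [DecidableEq α] {a b : α} (hab : a ≠ b) (n : ℕ)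
    (t : List α) : push a (alt b a n (b :: t)) = alt a b (n + 1) t := by
  have h (n : ℕ) (t : List α) : a :: alt b a n (b :: t) = alt a b (n + 1) t := by
    induction n with
    | zero => rfl
    | succ n ih => rw [alt, ih]; rfl
  rw [push, if_neg, h]
  rw [head?_alt_cons]
  simpa using hab.symm

theorem Code.toList_shapeR {r : RSemigroup.{u}} {t : List (Fin 3)} (h : Code r t) :
    (shapeR r).toList = t := by
  induction h with
  | idem b => rw [shapeR_idemGen]; rfl
  | idem_mul b r t h ih =>
    rw [map_mul, shapeR_idemGen, Word.toList_single_mul, ih]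
    exact push_cons_of_ne (side_not_ne b).symm _
  | arrow_mul b i r t h ih =>
    -- The word of the generator ends in the letter with which the word of `r` begins, and the two
    -- merge.
    have h1 : (Word.single (side (!b)) * shapeR r).toList = side (!b) :: t := by
      rw [Word.toList_single_mul, ih, push_cons_self]
    have h2 : (Word.single (1 : Fin 3) * powMul (Word.single (side (!b)) * Word.single 1) i
        (Word.single (side (!b)) * shapeR r)).toList =
          1 :: alt (side (!b)) 1 i (side (!b) :: t) := by
      rw [Word.toList_single_mul, Word.toList_powMul (side_ne_one _) _ _ (by rw [h1]; rfl), h1,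
        push, if_neg]
      rw [head?_alt_cons]
      simpa using side_ne_one _
    rw [map_mul, shapeR_arrowGen, mul_assoc, powMul_mul, mul_assoc, powMul_mul,
      Word.toList_single_mul, Word.toList_powMul (side_ne_one _).symm _ _ (by rw [h2]; rfl), h2,
      push_alt_swap (side_ne_one _)]
    rfl

theorem shapeR_injective : Function.Injective shapeR.{u} := by
  intro r r' h
  obtain ⟨t, ht⟩ := exists_code r
  obtain ⟨t', ht'⟩ := exists_code r'
  exact ht.unique ht' (by rw [← ht.toList_shapeR, ← ht'.toList_shapeR, h])

theorem exists_shapeR_eq {A : Type u} [Semigroup A] {β : A →ₙ* Copower (Fin 2) A}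
    (hβ : Coassociative β) (x : A) : ∃ r, shapeR.{u} r = shape β 0 1 2 x := by
  obtain ⟨v, hv⟩ := isLift_shape hβ x
  obtain ⟨r, hr⟩ := hv.exists_code (Word.ne_nil _)
  exact ⟨r, Word.ext hr.toList_shapeR⟩

/-- The homomorphism to `R` compatible with the canonical homomorphisms to reduced words. -/
noncomputable def toR {A : Type u} [Semigroup A] {β : A →ₙ* Copower (Fin 2) A}
    (hβ : Coassociative β) : A →ₙ* RSemigroup.{u} where
  toFun x := (exists_shapeR_eq hβ x).choose
  map_mul' x y := shapeR_injective <|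
    (exists_shapeR_eq hβ (x * y)).choose_spec.trans <| (map_mul _ x y).trans <|
      Eq.symm <| (map_mul shapeR _ _).trans <|
        congrArg₂ _ (exists_shapeR_eq hβ x).choose_spec (exists_shapeR_eq hβ y).choose_spec

theorem shapeR_comp_toR {A : Type u} [Semigroup A] {β : A →ₙ* Copower (Fin 2) A}
    (hβ : Coassociative β) : shapeR.comp (toR hβ) = shape β 0 1 2 :=
  MulHom.ext fun x => (exists_shapeR_eq hβ x).choose_spec

/-! ### Normal forms in copowers -/

namespace Copower

variable {ι : Type} {A : Type u} [Semigroup A]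

theorem induction {P : Copower ι A → Prop} (hinj : ∀ i x, P (inj i x))
    (hmul : ∀ x y, P x → P y → P (x * y)) (x : Copower ι A) : P x := by
  obtain ⟨w, rfl⟩ := Presented.mk_surjective x
  induction w using FreeSemigroup.recOnMul with
  | ih1 x => exact hinj x.1 x.2
  | ih2 x y hx hy =>
    rw [map_mul]
    exact hmul _ _ hx hy

variable [DecidableEq ι]

/-- Multiply an alternating list of factors on the left by one more factor. -/
def pushFactor (p : ι × A) : List (ι × A) → List (ι × A)
  | [] => [p]
  | q :: l => if p.1 = q.1 then (p.1, p.2 * q.2) :: l else p :: q :: l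

theorem pushFactor_pushFactor (i : ι) (x y : A) (l : List (ι × A)) :
    pushFactor (i, x) (pushFactor (i, y) l) = pushFactor (i, x * y) l := by
  cases l with
  | nil => simp [pushFactor]
  | cons q l =>
    by_cases h : i = q.1 <;> simp [pushFactor, h, mul_assoc]

/-- Multiplication by a factor, as a transformation. -/
def factorEnd (p : ι × A) : Function.End (List (ι × A)) := pushFactor p

/-- The action of a copower on lists of factors. -/
def act : Copower ι A →ₙ* Function.End (List (ι × A)) :=
  Presented.lift factorEnd (by
    rintro _ _ ⟨i, x, y⟩
    rw [map_mul, FreeSemigroup.lift_of, FreeSemigroup.lift_of, FreeSemigroup.lift_of]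
    exact funext (pushFactor_pushFactor i x y))

theorem act_inj (i : ι) (x : A) : act (inj i x) = pushFactor (i, x) :=
  Presented.lift_of _ _ _

theorem act_mul (x y : Copower ι A) (l : List (ι × A)) : act (x * y) l = act x (act y l) :=
  congrFun (map_mul act x y) l

/-- The list of factors of the normal form. -/
def factors (x : Copower ι A) : List (ι × A) := act x []

/-- Multiplying out the list of factors recovers the element. A unit is adjoined to give the empty
list a value. -/
theorem factors_injective : Function.Injective (factors : Copower ι A → List (ι × A)) := by
  let P (l : List (ι × A)) : WithOne (Copower ι A) :=
    (l.map fun p => (inj p.1 p.2 : WithOne (Copower ι A))).prod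
  have key (x : Copower ι A) : ∀ l, P (act x l) = x * P l := by
    induction x using induction with
    | hinj i x =>
      intro l
      rw [act_inj]
      cases l with
      | nil => simp [P, pushFactor]
      | cons q l =>
        obtain ⟨j, y⟩ := q
        by_cases h : i = j
        · subst h
          simp [P, pushFactor, ← mul_assoc]
        · simp [P, pushFactor, h]
    | hmul x y hx hy =>
      intro l
      rw [act_mul, hx, hy, WithOne.coe_mul, mul_assoc]
  intro x y hxy
  have hx := key x []
  have hy := key y []
  rw [show act x [] = act y [] from hxy, hy] at hx
  simpa [P] using hx.symm

theorem isChain_act (x : Copower ι A) : ∀ l : List (ι × A),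
    l.IsChain (fun p q => p.1 ≠ q.1) → (act x l).IsChain (fun p q => p.1 ≠ q.1) := by
  induction x using induction with
  | hinj i x =>
    intro l hl
    rw [act_inj]
    cases l with
    | nil => simp [pushFactor]
    | cons q l =>
      by_cases h : i = q.1
      · rw [pushFactor, if_pos h, List.isChain_cons]
        rw [List.isChain_cons] at hl
        exact ⟨fun r hr => by simpa [h] using hl.1 r hr, hl.2⟩
      · rw [pushFactor, if_neg h, List.isChain_cons]
        exact ⟨by simpa using h, hl⟩
  | hmul x y hx hy =>
    intro l hl
    rw [act_mul]
    exact hx _ (hy _ hl)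

theorem isChain_factors (x : Copower ι A) :
    (factors x).IsChain (fun p q => p.1 ≠ q.1) :=
  isChain_act x _ List.IsChain.nil

/-- The concatenation of the words of a list of factors. -/
def wordOf {α : Type*} [DecidableEq α] (g : ι → A →ₙ* Word α) (l : List (ι × A)) : List α :=
  l.foldr (fun p => pushAll id (g p.1 p.2).toList) []

theorem pushAll_id_toList_mul {α : Type*} [DecidableEq α] (x y : Word α) (t : List α) :
    pushAll id (x * y).toList t = pushAll id x.toList (pushAll id y.toList t) :=
  pushAll_pushAll id id _ _ _

theorem pushAll_id_nil {α : Type*} [DecidableEq α] (x : Word α) :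
    pushAll id x.toList [] = x.toList := by
  rw [pushAll_eq_map_append] <;> simp [x.isChain]

theorem wordOf_factors {α : Type*} [DecidableEq α] (g : ι → A →ₙ* Word α) (x : Copower ι A) :
    wordOf g (factors x) = (desc g x).toList := by
  have key (x : Copower ι A) :
      ∀ l, wordOf g (act x l) = pushAll id (desc g x).toList (wordOf g l) := by
    induction x using induction with
    | hinj i x =>
      intro l
      rw [act_inj, desc_inj]
      cases l with
      | nil => rfl
      | cons q l =>
        obtain ⟨j, y⟩ := q
        by_cases h : i = j
        · subst h
          simp [pushFactor, wordOf, pushAll_id_toList_mul]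
        · simp [pushFactor, wordOf, h]
    | hmul x y hx hy =>
      intro l
      rw [act_mul, hx, hy, map_mul, pushAll_id_toList_mul]
  exact (key x []).trans (pushAll_id_nil _)

/-- Homomorphisms to words are jointly injective on a copower, if they are injective and use
disjoint sets of letters. -/
theorem desc_injective {α : Type*} [DecidableEq α] (g : ι → A →ₙ* Word α) (σ : α → ι)
    (hσ : ∀ i x, ∀ a ∈ (g i x).toList, σ a = i) (hg : ∀ i, Function.Injective (g i)) :
    Function.Injective (desc g) := by
  have head (l : List (ι × A)) : (wordOf g l).head?.map σ = l.head?.map Prod.fst := by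
    cases l with
    | nil => rfl
    | cons p l =>
      obtain ⟨a, t, hat⟩ := List.exists_cons_of_ne_nil (g p.1 p.2).ne_nil
      have : σ a = p.1 := hσ p.1 p.2 a (by simp [hat])
      simp [wordOf, hat, pushAll_cons, head?_push, this]
  -- Neighbouring factors have different indices, hence use disjoint letters, so nothing merges
  -- between them.
  have cons (p : ι × A) (l : List (ι × A)) (h : (p :: l).IsChain (fun p q => p.1 ≠ q.1)) :
      wordOf g (p :: l) = (g p.1 p.2).toList ++ wordOf g l := by
    have hl : (wordOf g l).IsChain (· ≠ ·) := by
      cases l with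
      | nil => exact List.IsChain.nil
      | cons q l =>
        have (l : List (ι × A)) : (wordOf g l).IsChain (· ≠ ·) := by
          induction l with
          | nil => exact List.IsChain.nil
          | cons q l ih => exact isChain_pushAll _ _ ih
        exact this _
    refine (pushAll_eq_map_append ?_).trans (by rw [List.map_id]; rfl)
    rw [List.map_id, List.isChain_append]
    refine ⟨(g p.1 p.2).isChain, hl, ?_⟩
    rintro a ha b hb rfl
    have h1 : σ a = p.1 := hσ _ _ _ (List.mem_of_getLast? ha)
    have h2 := head l
    rw [show (wordOf g l).head? = some a from hb, Option.map_some, h1] at h2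
    obtain ⟨q, hq, hq'⟩ := Option.map_eq_some_iff.1 h2.symm
    exact (List.isChain_cons.1 h).1 q hq hq'.symm
  -- The first factor is recovered as the longest prefix whose letters have index `i`.
  have split (s t : List α) (i : ι) (hs : ∀ a ∈ s, σ a = i) (ht : t.head?.map σ ≠ some i) :
      (s ++ t).takeWhile (fun a => σ a = i) = s ∧ (s ++ t).dropWhile (fun a => σ a = i) = t := by
    induction s with
    | nil =>
      cases t with
      | nil => simp
      | cons b t =>
        have : σ b ≠ i := by simpa using ht
        simp [this]
    | cons a s ih =>
      have := ih fun b hb => hs b (by simp [hb])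
      simp [hs a (by simp), this]
  have hne (p : ι × A) (l : List (ι × A)) (h : (p :: l).IsChain (fun p q => p.1 ≠ q.1)) :
      (wordOf g l).head?.map σ ≠ some p.1 := by
    rw [head]
    intro h'
    obtain ⟨q, hq, hq'⟩ := Option.map_eq_some_iff.1 h'
    exact (List.isChain_cons.1 h).1 q hq hq'.symm
  have nil (l : List (ι × A)) (h : wordOf g l = []) : l = [] := by
    have := head l
    rw [h] at this
    cases l with
    | nil => rfl
    | cons p l => simp at this
  have key (l l' : List (ι × A)) (hl : l.IsChain (fun p q => p.1 ≠ q.1))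
      (hl' : l'.IsChain (fun p q => p.1 ≠ q.1)) (h : wordOf g l = wordOf g l') : l = l' := by
    induction l generalizing l' with
    | nil => exact (nil _ h.symm).symm
    | cons p l ih =>
      cases l' with
      | nil => exact nil _ h
      | cons q l' =>
        obtain ⟨i, x⟩ := p
        obtain ⟨j, y⟩ := q
        obtain rfl : i = j := by
          have := head ((i, x) :: l)
          rw [h, head] at this
          simpa using this.symm
        rw [cons _ _ hl, cons _ _ hl'] at h
        obtain ⟨h1, h2⟩ := split _ _ i (hσ i x) (hne _ _ hl)
        obtain ⟨h3, h4⟩ := split _ _ i (hσ i y) (hne _ _ hl')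
        dsimp only at h
        rw [h, h3] at h1
        rw [h, h4] at h2
        rw [hg i (Word.ext h1), ih l' hl.of_cons hl'.of_cons h2.symm]
  intro x y hxy
  refine factors_injective (key _ _ (isChain_factors x) (isChain_factors y) ?_)
  rw [wordOf_factors, wordOf_factors, hxy]

end Copower

/-! ### Words are determined by their images under merging maps -/

/-- Whether `a` merges with the next letter depends only on the side of that letter, which is the
same in both words. -/
theorem red_eq_of_red_cons_eq {α β : Type*} [DecidableEq β] {f : α → β} {σ : α → Bool} {a : α}
    (ha : ∀ b, σ b = σ a → f a = f b) (ha' : ∀ b, σ b ≠ σ a → f a ≠ f b) {s t : List α}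
    (hst : s.head?.map σ = t.head?.map σ) (h : red f (a :: s) = red f (a :: t)) :
    red f s = red f t := by
  cases s with
  | nil =>
    cases t with
    | nil => rfl
    | cons c t => simp at hst
  | cons b s =>
    cases t with
    | nil => simp at hst
    | cons c t =>
      have hbc : σ b = σ c := by simpa using hst
      by_cases hb : σ b = σ a
      · rwa [red_cons_cons_of_eq (ha b hb), red_cons_cons_of_eq (ha c (hbc ▸ hb))] at h
      · rwa [red_cons_cons_of_ne (ha' b hb), red_cons_cons_of_ne (ha' c (hbc ▸ hb)),
          List.cons_inj_right] at h

theorem head?_map_eq_of_red_eq {α β γ : Type*} [DecidableEq β] {f : α → β} {σ : α → γ}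
    (hf : ∀ a b, f a = f b → σ a = σ b)
    {s t : List α} (h : red f s = red f t) : s.head?.map σ = t.head?.map σ := by
  have h' := congrArg List.head? h
  rw [head?_red, head?_red] at h'
  cases s <;> cases t <;> simp at h' ⊢
  exact hf _ _ h'

/-- A reduced word is determined by its images under two maps of letters, each of which merges
the letters on one of two sides. -/
theorem eq_of_red_eq_of_red_eq {α β γ : Type*} [DecidableEq β] [DecidableEq γ] {f : α → β}
    {g : α → γ} (σ : α → Bool) (hf : ∀ a b, σ a = false → f b = f a → b = a)
    (hf' : ∀ a b, σ a = true → σ b = true → f a = f b)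
    (hg : ∀ a b, σ a = true → g b = g a → b = a)
    (hg' : ∀ a b, σ a = false → σ b = false → g a = g b) {s t : List α}
    (hs : s.IsChain (· ≠ ·)) (ht : t.IsChain (· ≠ ·)) (h₁ : red f s = red f t)
    (h₂ : red g s = red g t) : s = t := by
  have side (a b : α) (h : f a = f b) : σ a = σ b := by
    cases ha : σ a with
    | false => rw [hf a b ha h.symm, ha]
    | true =>
      cases hb : σ b with
      | false => rw [hf b a hb h, hb] at ha; exact ha.symm
      | true => rfl
  have side' (a b : α) (h : g a = g b) : σ a = σ b := by
    cases ha : σ a with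
    | true => rw [hg a b ha h.symm, ha]
    | false =>
      cases hb : σ b with
      | true => rw [hg b a hb h, hb] at ha; exact ha.symm
      | false => rfl
  induction s generalizing t with
  | nil => cases t with
    | nil => rfl
    | cons b t => exact absurd h₁.symm (push_ne_nil _ _)
  | cons a s ih => cases t with
    | nil => exact absurd h₁ (push_ne_nil _ _)
    | cons b t =>
      have hf₁ : f a = f b := by simpa [head?_red] using congrArg List.head? h₁
      have hg₁ : g a = g b := by simpa [head?_red] using congrArg List.head? h₂
      -- The map that isolates the first letter lets it be cancelled and shows on which side the
      -- next letter lies; this tells whether the first letter merges under the other map, so it can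
      -- be cancelled there too.
      cases ha : σ a with
      | false =>
        obtain rfl := hf a b ha hf₁.symm
        rw [red_cons_of_unique hs fun c => hf _ c ha, red_cons_of_unique ht fun c => hf _ c ha,
          List.cons_inj_right] at h₁
        rw [ih hs.of_cons ht.of_cons h₁ (red_eq_of_red_cons_eq (σ := σ)
          (fun c hc => hg' _ c ha (hc.trans ha)) (fun c hc h => hc ?_) (head?_map_eq_of_red_eq side h₁) h₂)]
        rw [hg c _ (by simpa [ha] using hc) h]
      | true =>
        obtain rfl := hg a b ha hg₁.symm
        rw [red_cons_of_unique hs fun c => hg _ c ha, red_cons_of_unique ht fun c => hg _ c ha,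
          List.cons_inj_right] at h₂
        rw [ih hs.of_cons ht.of_cons (red_eq_of_red_cons_eq (σ := σ)
          (fun c hc => hf' _ c ha (hc.trans ha)) (fun c hc h => hc ?_)
          (head?_map_eq_of_red_eq side' h₂) h₁) h₂]
        rw [hf c _ (by simpa [ha] using hc) h]

theorem Word.eq_of_map_eq_of_map_eq {m n k : ℕ} {f : Fin m → Fin n} {g : Fin m → Fin k}
    (σ : Fin m → Bool) (hf : ∀ a b, σ a = false → f b = f a → b = a)
    (hf' : ∀ a b, σ a = true → σ b = true → f a = f b)
    (hg : ∀ a b, σ a = true → g b = g a → b = a)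
    (hg' : ∀ a b, σ a = false → σ b = false → g a = g b) {x y : Word (Fin m)}
    (h₁ : Word.map f x = Word.map f y) (h₂ : Word.map g x = Word.map g y) : x = y :=
  Word.ext (eq_of_red_eq_of_red_eq σ hf hf' hg hg' x.isChain y.isChain
    (congrArg Word.toList h₁) (congrArg Word.toList h₂))

/-- The merging maps from six letters to three that keep two adjacent cuts. -/
theorem Word.eq_of_merge_eq {x y : Word (Fin 6)}
    (h : ∀ f ∈ [![(0 : Fin 3), 1, 2, 2, 2, 2], ![0, 0, 1, 2, 2, 2], ![0, 0, 0, 1, 2, 2],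
      ![0, 0, 0, 0, 1, 2]], Word.map f x = Word.map f y) : x = y := by
  have comp {m n k : ℕ} (f : Fin m → Fin n) (g : Fin n → Fin k) (x : Word (Fin m)) :
      Word.map g (Word.map f x) = Word.map (g ∘ f) x :=
    Word.ext (pushAll_pushAll f g _ _ _)
  have step {x y : Word (Fin 4)} (h₁ : Word.map ![(0 : Fin 3), 1, 2, 2] x = Word.map _ y)
      (h₂ : Word.map ![(0 : Fin 3), 0, 1, 2] x = Word.map _ y) : x = y :=
    Word.eq_of_map_eq_of_map_eq ![false, false, true, true] (by decide) (by decide) (by decide)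
      (by decide) h₁ h₂
  -- Of the five cuts between six letters, one map keeps the first three and the other the last
  -- three. The same criterion then reduces three cuts to two adjacent ones.
  refine Word.eq_of_map_eq_of_map_eq (f := ![(0 : Fin 4), 1, 2, 3, 3, 3])
    (g := ![(0 : Fin 4), 0, 0, 1, 2, 3]) ![false, false, false, true, true, true]
    (by decide) (by decide) (by decide) (by decide) (step ?_ ?_) (step ?_ ?_)
  all_goals
    rw [comp, comp]
    exact h _ (by decide)

/-! ### Morphisms of cosemigroups to `R` -/

section

variable {A : Type u} [Semigroup A] {β : A →ₙ* Copower (Fin 2) A}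

/-- The product of six letters. -/
def shapeSix (β : A →ₙ* Copower (Fin 2) A) : A →ₙ* Word (Fin 6) :=
  conv β (shape β 0 1 2) (shape β 3 4 5)

/-- By coassociativity the image is a product of six letters in which 0, 1, 2 occur in order with
repetitions, and idempotence removes these. -/
theorem map_shapeSix (hβ : Coassociative β) {f : Fin 6 → Fin 3}
    (hf : f ∈ [![(0 : Fin 3), 1, 2, 2, 2, 2], ![0, 0, 1, 2, 2, 2], ![0, 0, 0, 1, 2, 2],
      ![0, 0, 0, 0, 1, 2]]) (x : A) :
    Word.map f (shapeSix β x) = shape β 0 1 2 x := by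
  have key : (Word.map f).comp (shapeSix β) = shape β 0 1 2 := by
    rw [shapeSix, comp_conv, map_comp_shape, map_comp_shape]
    have idem (a : Fin 3) (g : A →ₙ* Word (Fin 3)) :
        conv β (letter A a) (conv β (letter A a) g) = conv β (letter A a) g := by
      rw [← hβ.conv_assoc, conv_letter_self]
    simp only [List.mem_cons, List.not_mem_nil, or_false] at hf
    rcases hf with rfl | rfl | rfl | rfl <;>
      simp [shape, hβ.conv_assoc, idem, conv_letter_self]
  exact DFunLike.congr_fun key x

theorem conv_inj (β : A →ₙ* Copower (Fin 2) A) :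
    conv β (Copower.inj 0) (Copower.inj 1) = β := by
  have : Copower.desc ![Copower.inj 0, Copower.inj 1] = MulHom.id (Copower (Fin 2) A) :=
    Copower.hom_ext fun i x => by fin_cases i <;> exact Copower.desc_inj _ _ _
  rw [conv, this]
  rfl

theorem desc_shapeR_injective :
    Function.Injective (Copower.desc ![shape beta.{u} (0 : Fin 6) 1 2, shape beta 3 4 5]) := by
  have lift (f : Fin 3 → Fin 6) (hf : Function.Injective f) :
      Function.Injective (shape beta.{u} (f 0) (f 1) (f 2)) ∧
        ∀ x, ∀ a ∈ (shape beta.{u} (f 0) (f 1) (f 2) x).toList, ∃ c, f c = a := by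
    rw [← map_comp_shape]
    have hlist (x : RSemigroup.{u}) :
        ((Word.map f).comp (shape beta 0 1 2) x).toList = (shapeR x).toList.map f :=
      Word.toList_map_of_injective hf _
    refine ⟨fun x y h => shapeR_injective (Word.ext ?_), fun x a ha => ?_⟩
    · have := congrArg Word.toList h
      rw [hlist, hlist] at this
      exact List.map_injective_iff.2 hf this
    · rw [hlist] at ha
      obtain ⟨c, -, hc⟩ := List.mem_map.1 ha
      exact ⟨c, hc⟩
  have h0 := lift ![0, 1, 2] (by decide)
  have h1 := lift ![3, 4, 5] (by decide)
  refine Copower.desc_injective _ ![(0 : Fin 2), 0, 0, 1, 1, 1] ?_ ?_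
  · intro i x a ha
    fin_cases i
    · obtain ⟨c, rfl⟩ := h0.2 x a ha
      clear * - c
      revert c; decide
    · obtain ⟨c, rfl⟩ := h1.2 x a ha
      clear * - c
      revert c; decide
  · intro i
    fin_cases i
    · exact h0.1
    · exact h1.1

theorem beta_comp_toR (hβ : Coassociative β) :
    beta.{u}.comp (toR hβ) = (Copower.map (toR hβ)).comp β := by
  set h := toR hβ with hh
  have hshape (f : Fin 3 → Fin 6) :
      (shape beta.{u} (f 0) (f 1) (f 2)).comp h = shape β (f 0) (f 1) (f 2) := by
    rw [← map_comp_shape, MulHom.comp_assoc, shapeR_comp_toR, map_comp_shape]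
  have h0 : (shape beta.{u} (0 : Fin 6) 1 2).comp h = shape β 0 1 2 := hshape ![0, 1, 2]
  have h1 : (shape beta.{u} (3 : Fin 6) 4 5).comp h = shape β 3 4 5 := hshape ![3, 4, 5]
  ext x
  apply desc_shapeR_injective
  have hR : Copower.desc ![shape beta.{u} (0 : Fin 6) 1 2, shape beta 3 4 5]
      ((Copower.map h).comp β x) = shapeSix β x := by
    have : (Copower.desc ![shape beta.{u} (0 : Fin 6) 1 2, shape beta 3 4 5]).comp
        (Copower.map h) = Copower.desc ![shape β 0 1 2, shape β 3 4 5] :=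
      Copower.hom_ext fun i x => by
        fin_cases i <;> simp [Copower.map, Copower.desc_inj, ← h0, ← h1]
    exact DFunLike.congr_fun this (β x)
  rw [hR]
  -- After each merge both sides are values of 0·1·2, which agree by the choice of `toR`.
  refine Word.eq_of_merge_eq fun f hf => ?_
  rw [map_shapeSix hβ hf]
  refine (map_shapeSix coassociative_beta hf (h x)).trans ?_
  exact DFunLike.congr_fun (shapeR_comp_toR hβ) x

theorem eq_toR (hβ : Coassociative β) {k : A →ₙ* RSemigroup.{u}}
    (hk : beta.comp k = (Copower.map k).comp β) : k = toR hβ := by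
  ext x
  apply shapeR_injective
  exact (DFunLike.congr_fun (shape_comp hk (0 : Fin 3) 1 2) x).trans
    (DFunLike.congr_fun (shapeR_comp_toR hβ) x).symm

end

/-! ### The functor represented by `R` -/

namespace Tuple

variable {A : Type u} [Semigroup A]

/-- The homomorphism from `R` determined by a tuple. -/
def toHom (t : Tuple A) : RSemigroup.{u} →ₙ* A :=
  Presented.lift (fun x => match x with
    | .x00 => t.a
    | .x11 => t.b
    | .p i => t.c i
    | .q i => t.d i) (by
    rintro _ _ (_ | _ | i | i | i | i) <;> simp only [map_mul, FreeSemigroup.lift_of]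
    exacts [t.a_mul_a, t.b_mul_b, t.a_mul_c i, t.c_mul_b i, t.b_mul_d i, t.d_mul_a i])

theorem evalGen_toHom (t : Tuple A) : evalGen (A := A) t.toHom = t :=
  Tuple.ext (Presented.lift_of _ _ _) (Presented.lift_of _ _ _)
    (funext fun _ => Presented.lift_of _ _ _) (funext fun _ => Presented.lift_of _ _ _)

end Tuple

section

variable {A : Type u} [Semigroup A]

/-- The tuple of images of the generators. -/
abbrev evalHom (f : RSemigroup.{u} →ₙ* A) : Tuple A := evalGen (A := A) f

theorem evalHom_injective : Function.Injective (evalHom (A := A)) := by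
  intro f g h
  refine Presented.hom_ext fun x => ?_
  cases x with
  | x00 => exact congrArg Tuple.a h
  | x11 => exact congrArg Tuple.b h
  | p i => exact congrFun (congrArg Tuple.c h) i
  | q i => exact congrFun (congrArg Tuple.d h) i

theorem evalHom_conv (f g : RSemigroup.{u} →ₙ* A) :
    evalHom (conv beta f g) = evalHom f * evalHom g :=
  Tuple.ext (conv_beta_gen f g .x00) (conv_beta_gen f g .x11)
    (funext fun i => conv_beta_gen f g (.p i)) (funext fun i => conv_beta_gen f g (.q i))

/-- Homomorphisms from `R` correspond to tuples. -/
def pointsEquiv (A : Type u) [Semigroup A] : R.{u}.Points A ≃* Tuple A where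
  toFun := evalGen
  invFun := Tuple.toHom
  left_inv _ := evalHom_injective (Tuple.evalGen_toHom _)
  right_inv := Tuple.evalGen_toHom
  map_mul' := evalHom_conv

theorem Tuple.toHom_evalHom (f : RSemigroup.{u} →ₙ* A) : (evalHom f).toHom = f :=
  (pointsEquiv A).left_inv f

theorem Tuple.toHom_mul (t t' : Tuple A) :
    (t * t').toHom = conv beta t.toHom t'.toHom :=
  map_mul (pointsEquiv A).symm t t'

theorem Tuple.toHom_map {A B : Semigrp.{u}} (k : A ⟶ B) (t : Tuple A) :
    Tuple.toHom ((E.map k).hom t) = k.hom.comp t.toHom := by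
  apply evalHom_injective
  refine (Tuple.evalGen_toHom _).trans ?_
  nth_rw 1 [← t.evalGen_toHom]
  rfl

end

/-- The functor represented by `R` is isomorphic to `E`. -/
def representedFunctorIso : R.{u}.representedFunctor ≅ E.{u} :=
  NatIso.ofComponents (fun A => (pointsEquiv A).toSemigrpIso) fun _ => rfl

/-- `E` is corepresented by the underlying semigroup of `R`. -/
def corepresentableE : (E.{u} ⋙ forget Semigrp.{u}).CorepresentableBy (Semigrp.of RSemigroup) where
  homEquiv {A} :=
    { toFun := fun f => evalHom (A := A) f.hom
      invFun := fun t => Semigrp.ofHom (Tuple.toHom (A := A) t)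
      left_inv := fun f => Semigrp.hom_ext (Tuple.toHom_evalHom f.hom)
      right_inv := fun t => Tuple.evalGen_toHom (A := A) t }
  homEquiv_comp _ _ := rfl

/-! ### The cosemigroup of a representable functor -/

section

variable {F : Semigrp.{u} ⥤ Semigrp.{u}} {X : Semigrp.{u}}
  (e : (F ⋙ forget Semigrp.{u}).CorepresentableBy X)

/-- The bijection of a representation, on unbundled homomorphisms. -/
def homEquivObj (A : Type u) [Semigroup A] : (X →ₙ* A) ≃ F.obj (Semigrp.of A) where
  toFun f := e.homEquiv (Semigrp.ofHom f)
  invFun t := (e.homEquiv.symm t).hom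
  left_inv f := congrArg Semigrp.Hom.hom (e.homEquiv.symm_apply_apply (Semigrp.ofHom f))
  right_inv t := e.homEquiv.apply_symm_apply t

theorem homEquivObj_comp {A B : Type u} [Semigroup A] [Semigroup B] (k : A →ₙ* B)
    (f : X →ₙ* A) :
    homEquivObj e B (k.comp f) = (F.map (Semigrp.ofHom k)).hom (homEquivObj e A f) :=
  e.homEquiv_comp (Semigrp.ofHom k) (Semigrp.ofHom f)

/-- The co-operation on a semigroup that represents a semigroup-valued functor. -/
def coOperation : X →ₙ* Copower (Fin 2) X :=
  (homEquivObj e _).symm (homEquivObj e _ (Copower.inj 0) * homEquivObj e _ (Copower.inj 1))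

theorem homEquivObj_conv {A : Type u} [Semigroup A] (f g : X →ₙ* A) :
    homEquivObj e A (conv (coOperation e) f g) = homEquivObj e A f * homEquivObj e A g := by
  rw [conv, homEquivObj_comp, coOperation, Equiv.apply_symm_apply, map_mul, ← homEquivObj_comp,
    ← homEquivObj_comp]
  rfl

/-- The representation carries products of homomorphisms to products in `F`, so associativity there
is transported back. -/
theorem coassociative_coOperation : Coassociative (coOperation e) :=
  (homEquivObj e _).injective (by simp only [homEquivObj_conv, mul_assoc])

/-- The natural transformation from `E` to a representable functor. -/
noncomputable def fromE : E.{u} ⟶ F where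
  app A := Semigrp.ofHom (X := Tuple A) (Y := F.obj A)
    { toFun := fun t =>
        homEquivObj e A (t.toHom.comp (toR (coassociative_coOperation e)))
      map_mul' := fun t t' => by
        rw [Tuple.toHom_mul, conv_comp (beta_comp_toR _)]
        exact homEquivObj_conv e _ _ }
  naturality A B k := Semigrp.hom_ext <| MulHom.ext fun t =>
    (congrArg (fun f => homEquivObj e B (f.comp (toR (coassociative_coOperation e))))
      (Tuple.toHom_map k t)).trans
      (homEquivObj_comp e k.hom
        ((Tuple.toHom (A := A) t).comp (toR (coassociative_coOperation e))))

theorem eq_fromE (τ : E.{u} ⟶ F) : τ = fromE e := by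
  -- By Yoneda, `τ` is determined by its value at the universal tuple of generators, that is, by
  -- this homomorphism.
  let k : X →ₙ* RSemigroup.{u} :=
    (homEquivObj e _).symm ((τ.app (Semigrp.of RSemigroup)).hom (evalHom (MulHom.id _)))
  have key (A : Type u) [Semigroup A] (f : RSemigroup.{u} →ₙ* A) :
      (τ.app (Semigrp.of A)).hom (evalHom f) = homEquivObj e A (f.comp k) := by
    rw [homEquivObj_comp, Equiv.apply_symm_apply]
    exact DFunLike.congr_fun (congrArg Semigrp.Hom.hom (τ.naturality (Semigrp.ofHom f)))
      (evalHom (MulHom.id _))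
  -- A co-operation is the product of the two coprojections, so multiplicativity of `τ` at `R ∐ R`
  -- says exactly that `k` respects the co-operations.
  have hk : beta.comp k = (Copower.map k).comp (coOperation e) := by
    apply (homEquivObj e _).injective
    have h : (Copower.map k).comp (coOperation e) =
        conv (coOperation e) ((Copower.inj 0).comp k) ((Copower.inj 1).comp k) := by
      conv_lhs => rw [← conv_inj (coOperation e), comp_conv]
      rfl
    rw [h, homEquivObj_conv, ← key, ← key, ← key]
    exact (congrArg (τ.app _).hom ((congrArg evalHom (conv_inj beta).symm).trans
      (evalHom_conv _ _))).trans (map_mul (τ.app _).hom _ _)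
  refine NatTrans.ext <| funext fun A => Semigrp.hom_ext <| MulHom.ext fun t => ?_
  have h := key A (Tuple.toHom (A := A) t)
  rw [eq_toR (coassociative_coOperation e) hk] at h
  exact (congrArg (τ.app A).hom (Tuple.evalGen_toHom (A := A) t).symm).trans h

end

end FinalCosemigroup

/-! ### Finality of `R` and initiality of `E` -/

open FinalCosemigroup in
theorem isTerminal_R : Nonempty (IsTerminal R.{u}) :=
  ⟨IsTerminal.ofUniqueHom (fun S => ⟨toR S.coassoc, beta_comp_toR S.coassoc⟩)
    fun S m => Cosemigroup.Hom.ext (eq_toR S.coassoc m.comm)⟩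

theorem theoremT :
    Nonempty (IsTerminal FinalCosemigroup.R.{u}) ∧
    (∃ e : FinalCosemigroup.R.{u}.representedFunctor ≅ FinalCosemigroup.E.{u},
      ∀ (A : Semigrp.{u}) (f : FinalCosemigroup.R.{u}.Points A),
        (e.hom.app A).hom f = FinalCosemigroup.evalGen f) ∧
    (∃ hE : IsRepresentableFunctor FinalCosemigroup.E.{u},
      Nonempty (IsInitial (⟨FinalCosemigroup.E.{u}, hE⟩ : RepresentableFunctor.{u}))) := by
  have rep (Y : RepresentableFunctor.{u}) :
      ∃ X, Nonempty ((Y.obj ⋙ forget Semigrp.{u}).CorepresentableBy X) :=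
    Y.property.has_corepresentation
  exact ⟨isTerminal_R, ⟨FinalCosemigroup.representedFunctorIso, fun _ _ => rfl⟩,
    FinalCosemigroup.corepresentableE.isCorepresentable,
    ⟨IsInitial.ofUniqueHom
      (fun Y => ObjectProperty.homMk (FinalCosemigroup.fromE (rep Y).choose_spec.some))
      fun Y m => ObjectProperty.hom_ext _ (FinalCosemigroup.eq_fromE _ m.hom)⟩⟩
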